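/- Let $q\in[0,1)$, $N\in\mathbb N$ and $K\subseteq\{1,\dots,N\}$ (the fixed set of allowed prediction periods; time runs backwards, $N,N-1,\dots,1,0$). Let $A_i\sim N(0,q)$ and $B_i\sim N(0,1-q)$ ($1\le i\le N$) be independent steps, let the outcome $X_0$ be independent of them and unconstrained by a prior (flat prior), and put $X_t=X_0+\sum_{i\le t}(A_i+B_i)$, $Y_t=X_0+\sum_{i\le t}B_i$. At period $t$ the signal $X_t$ becomes public, and the expert also observes $Y_t$ privately. All probabilities below are conditional on the first public signal $X_N=x$, for an arbitrary $x\in\mathbb R$; under the flat prior, the steps then keep their law and $X_0=x-\sum_{i\le N}(A_i+B_i)$. At every $t\in K$ the expert may stay silent, or announce a number $z$ (a function of what he knows). If the market's densities for the outcome just before and just after a prediction are $f_-$ and $f_+$, he earns $\log(f_+(x_0)/f_-(x_0))$ for it; silence earns $0$. Given his signals up to period $t$ his posterior for $X_0$ is $N(Y_t,(1-q)t)$, and a prediction at $t$ is truthful if it announces $Y_t$. The market takes predictions at face value if its distribution of the outcome is $N(z,(1-q)t)$ just after $z$ is announced at $t$; $N(x_t,t)$ at $t$ if no prediction has been made; and,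 at $t<T$ when the latest prediction announced $z$ at $T$, the distribution $N(\mu_{t-},\sigma_{t-}^2)$ with $$\sigma_{t-}^2=\frac{1}{\frac1t+\frac{q}{1-q}\frac1T},\qquad \mu_{t-}=\sigma_{t-}^2\Bigl(\frac{x_t}{t}+\frac{1}{1-q}\frac{z}{T}-\frac{x_T}{T}\Bigr).$$ Write $\sigma_{T+}^2=(1-q)T$, and let $\mathbb E_T$ be the conditional expectation given the expert's information (all $X_i,Y_i$ with $T\le i\le N$) at period $T$. Then: 1. The profile in which the expert predicts truthfully at every period of $K$ and the market takes his predictions at face value is an equilibrium. That is: (a) if the expert is truthful, then at every period, just before and just after his prediction, the market's distribution is the Bayesian posterior of $X_0$ given all public signals and predictions so far; (b) if the market takes predictions at face value, then at every period and after any past record of predictions, being truthful at all remaining periods of $K$ has a finite expected remaining reward given the expert's information, and every other policy (with predictions, truthful or not, and silences depending on what he knows) whose negative part of the remaining reward is integrable has an integrable remaining reward, with conditional expectation at most that of the truthful policy. 2. If $1\le t<T\le N$ and the latest prediction before $t$ is made at $T$, then announcing $z+c_T$ instead of $z$ at $T$ shifts the market mean just before a prediction at $t$ by exactly $$c_t=\frac{\sigma_{t-}^2}{\sigma_{T+}^2}\,c_T,$$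 whatever the signals, and leaves the market variance $\sigma_{t-}^2$ unchanged. 3. Consider any policy that makes a prediction at $T\in K$ and its next prediction at a period $t$ with $1\le t<T$, where $t$ is fixed, or, more generally, is a stopping time for the expert's information at $T$ together with the public signals revealed after $T$. Let $c_T$ be a square-integrable function of the expert's information at $T$. If $\Delta W$ is the difference between the total rewards from announcing $Y_T+c_T$ and from announcing $Y_T$ at $T$, all other actions being the same, then $$\mathbb E_T[\Delta W]=\mathbb E_T\Bigl[\frac{c_t^2}{2\sigma_{t-}^2}\Bigr]-\frac{c_T^2}{2\sigma_{T+}^2}\le 0\quad\text{almost surely.}$$ -/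

import Mathlib

open MeasureTheory ProbabilityTheory

/-! ### The signals

Time runs backwards: period `N` is the first one, and the outcome is revealed at period `0`. -/

/-- A state of the world `(x₀, A, B)`: the outcome, the parts `A i` of the market steps that the
expert knows, and the parts `B i` that he does not know.  Only the steps `1, …, N` are used. -/
abbrev World : Type := ℝ × (ℕ → ℝ) × (ℕ → ℝ)

/-- The outcome `X₀`. -/
def outcome (ω : World) : ℝ := ω.1

/-- The market's signal `X_t = X₀ + Z_1 + … + Z_t`, where `Z_i = A_i + B_i`. -/
def marketSignal (t : ℕ) (ω : World) : ℝ :=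
  ω.1 + ∑ i ∈ Finset.Icc 1 t, (ω.2.1 i + ω.2.2 i)

/-- The expert's private signal `Y_t = X₀ + B_1 + … + B_t`. -/
def expertSignal (t : ℕ) (ω : World) : ℝ :=
  ω.1 + ∑ i ∈ Finset.Icc 1 t, ω.2.2 i

/-- The law of the steps: all `A_i ∼ N(0, q)` and `B_i ∼ N(0, 1 - q)`, independent. -/
noncomputable def stepLaw (q : ℝ) : Measure ((ℕ → ℝ) × (ℕ → ℝ)) :=
  (Measure.infinitePi fun _ : ℕ => gaussianReal 0 q.toNNReal).prod
    (Measure.infinitePi fun _ : ℕ => gaussianReal 0 (1 - q).toNNReal)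

/-- The model with an outcome that is unconstrained by a prior (the flat, improper prior),
independent of the steps. -/
noncomputable def flatLaw (q : ℝ) : Measure World :=
  (volume : Measure ℝ).prod (stepLaw q)

/-- The world with first public signal `X_N = x` and steps `ab`. -/
def worldFrom (N : ℕ) (x : ℝ) (ab : (ℕ → ℝ) × (ℕ → ℝ)) : World :=
  (x - ∑ i ∈ Finset.Icc 1 N, (ab.1 i + ab.2 i), ab)

/-- The law of the world given the first public signal `X_N = x`: a random walk, reversed in time,
that starts at `x`. -/
noncomputable def worldLaw (q : ℝ) (N : ℕ) (x : ℝ) : Measure World :=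
  (stepLaw q).map (worldFrom N x)

instance (q : ℝ) : IsProbabilityMeasure (stepLaw q) := by
  unfold stepLaw; infer_instance

theorem measurable_worldFrom (N : ℕ) (x : ℝ) : Measurable (worldFrom N x) := by
  unfold worldFrom; fun_prop

instance (q : ℝ) (N : ℕ) (x : ℝ) : IsProbabilityMeasure (worldLaw q N x) :=
  Measure.isProbabilityMeasure_map (measurable_worldFrom N x).aemeasurable

/-! ### The players' actions -/

/-- What the expert knows at period `t`: all market and expert signals of the periods `N, …, t`. -/
def expertInfo (N t : ℕ) : MeasurableSpace World :=
  ⨆ i ∈ Finset.Icc t N,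
    (MeasurableSpace.comap (marketSignal i) inferInstance ⊔
      MeasurableSpace.comap (expertSignal i) inferInstance)

/-- An action at a period is `none` (silence) or `some z` (a prediction with announced mean `z`).
This injective encoding gives actions their measurable structure. -/
def encode (o : Option ℝ) : Bool × ℝ := (o.isSome, o.getD 0)

/-- A policy of the expert: at every allowed period (an element of `K`) he stays silent or makes
a prediction, which need not be truthful, depending on what he knows then. -/
structure Policy (N : ℕ) (K : Finset ℕ) where
  act : ℕ → World → Option ℝ
  silent : ∀ t, t ∉ K → ∀ ω, act t ω = none
  measurable : ∀ t, Measurable[expertInfo N t] fun ω => encode (act t ω)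

/-- The market's beliefs: the densities of its distribution of the outcome just before and just
after the expert's action at period `t`, given the market signals `x` and the public record `r` of
actions, and depending only on what is public then. -/
structure MarketRule (N : ℕ) where
  before : ℕ → (ℕ → ℝ) → (ℕ → Option ℝ) → ℝ → ℝ
  after : ℕ → (ℕ → ℝ) → (ℕ → Option ℝ) → ℝ → ℝ
  before_adapted : ∀ t x x' r r', t ≤ N → (∀ i ∈ Finset.Icc t N, x i = x' i) →
    (∀ i ∈ Finset.Ioc t N, r i = r' i) → before t x r = before t x' r'
  after_adapted : ∀ t x x' r r', t ≤ N → (∀ i ∈ Finset.Icc t N, x i = x' i) →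
    (∀ i ∈ Finset.Icc t N, r i = r' i) → after t x r = after t x' r'

/-- The score `log (f₊(x₀) / f₋(x₀))` of the action at period `t`; silence earns `0`. -/
noncomputable def reward {N : ℕ} (β : MarketRule N) (r : ℕ → Option ℝ) (t : ℕ) (ω : World) : ℝ :=
  if (r t).isSome then
    Real.log (β.after t (fun i => marketSignal i ω) r (outcome ω) /
      β.before t (fun i => marketSignal i ω) r (outcome ω))
  else 0

/-- The public record when the actions before period `s` (that is, at periods `> s`) were `r`, and
the policy `π` is followed from period `s` on. -/
def record {N : ℕ} {K : Finset ℕ} (π : Policy N K) (s : ℕ) (r : ℕ → Option ℝ) (ω : World) :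
    ℕ → Option ℝ :=
  fun i => if i ≤ s then π.act i ω else r i

/-- The total reward of `π` from period `s` on, after the past actions `r`. -/
noncomputable def rewardFrom {N : ℕ} {K : Finset ℕ} (β : MarketRule N) (π : Policy N K) (s : ℕ)
    (r : ℕ → Option ℝ) (ω : World) : ℝ :=
  ∑ t ∈ Finset.Icc 1 s, reward β (record π s r ω) t ω

/-- The total reward of a policy. -/
noncomputable def totalReward {N : ℕ} {K : Finset ℕ} (β : MarketRule N) (π : Policy N K)
    (ω : World) : ℝ :=
  rewardFrom β π N (fun _ => none) ω

/-- What is public when the expert follows `π`: the market signals of the periods `N, …, t` and the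
expert's actions at the periods `N, …, u`. -/
def publicInfo {N : ℕ} {K : Finset ℕ} (π : Policy N K) (t u : ℕ) : MeasurableSpace World :=
  (⨆ i ∈ Finset.Icc t N, MeasurableSpace.comap (marketSignal i) inferInstance) ⊔
    ⨆ i ∈ Finset.Icc u N, MeasurableSpace.comap (fun ω => encode (π.act i ω)) inferInstance

/-- The conditional law of the outcome given the information `m`. -/
noncomputable def outcomeGiven (q : ℝ) (N : ℕ) (x : ℝ) (m : MeasurableSpace World) (ω : World) :
    Measure ℝ :=
  @Measure.map World ℝ Prod.instMeasurableSpace _ outcome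
    (@condExpKernel World Prod.instMeasurableSpace _ (worldLaw q N x) _ m ω)

/-- The policy `π` and the beliefs `β` are an equilibrium, given the first public signal `x`. -/
structure IsEquilibrium (q : ℝ) (N : ℕ) (K : Finset ℕ) (x : ℝ) (π : Policy N K)
    (β : MarketRule N) : Prop where
  /-- At every period, just before and just after the expert's action, the market's distribution
  is the Bayesian posterior given the public information, if the expert follows `π`. -/
  bayes_before : ∀ t ∈ Finset.Icc 1 N, ∀ᵐ ω ∂(worldLaw q N x),
    outcomeGiven q N x (publicInfo π t (t + 1)) ω =
      volume.withDensity fun y => ENNReal.ofReal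
        (β.before t (fun i => marketSignal i ω) (fun i => π.act i ω) y)
  bayes_after : ∀ t ∈ Finset.Icc 1 N, ∀ᵐ ω ∂(worldLaw q N x),
    outcomeGiven q N x (publicInfo π t t) ω =
      volume.withDensity fun y => ENNReal.ofReal
        (β.after t (fun i => marketSignal i ω) (fun i => π.act i ω) y)
  /-- At every period `s` and after any past actions `r`, following `π` has a finite expected
  future reward, -/
  integrable : ∀ s ∈ Finset.Icc 1 N, ∀ r : ℕ → Option ℝ,
    Integrable (rewardFrom β π s r) (worldLaw q N x)
  /-- and no policy (without infinite expected losses) has a higher one, given what the expert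
  knows. -/
  optimal : ∀ s ∈ Finset.Icc 1 N, ∀ r : ℕ → Option ℝ, ∀ π' : Policy N K,
    ∫⁻ ω, ENNReal.ofReal (-rewardFrom β π' s r ω) ∂(worldLaw q N x) ≠ ⊤ →
      Integrable (rewardFrom β π' s r) (worldLaw q N x) ∧
      (worldLaw q N x)[rewardFrom β π' s r | expertInfo N s] ≤ᵐ[worldLaw q N x]
        (worldLaw q N x)[rewardFrom β π s r | expertInfo N s]

/-! ### Truthful predictions and a market that takes them at face value -/

theorem measurable_expertSignal (N t : ℕ) (ht : t ≤ N) :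
    Measurable[expertInfo N t] (expertSignal t) := by
  have h : MeasurableSpace.comap (expertSignal t) inferInstance ≤ expertInfo N t :=
    le_sup_right.trans (le_iSup₂_of_le (f := fun i (_ : i ∈ Finset.Icc t N) =>
      MeasurableSpace.comap (marketSignal i) inferInstance ⊔
        MeasurableSpace.comap (expertSignal i) inferInstance) t (by simp [ht]) le_rfl)
  exact (comap_measurable (expertSignal t)).mono h le_rfl

theorem measurable_encode_some {m : MeasurableSpace World} {z : World → ℝ} (hz : Measurable[m] z) :
    Measurable[m] fun ω => encode (some (z ω)) :=
  measurable_const.prodMk hz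

/-- The truthful policy: at every allowed period, announce one's signal (that is, one's posterior
mean of the outcome). -/
def truthful {N : ℕ} {K : Finset ℕ} (hK : K ⊆ Finset.Icc 1 N) : Policy N K where
  act t ω := if t ∈ K then some (expertSignal t ω) else none
  silent t ht ω := by simp [ht]
  measurable t := by
    by_cases ht : t ∈ K
    · simpa only [ht, if_true] using measurable_encode_some
        (measurable_expertSignal N t (Finset.mem_Icc.1 (hK ht)).2)
    · simpa only [ht, if_false] using measurable_const

/-- The policy `π`, except that at the allowed period `T` the expert announces the mean
`Y_T + c` (so `c` is the size of the misreport, and `c = 0` is the truthful prediction). -/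
def Policy.misreport {N : ℕ} {K : Finset ℕ} (π : Policy N K) (hK : K ⊆ Finset.Icc 1 N)
    (T : ℕ) (hT : T ∈ K) (c : World → ℝ) (hc : Measurable[expertInfo N T] c) : Policy N K where
  act t ω := if t = T then some (expertSignal T ω + c ω) else π.act t ω
  silent t ht ω := by
    have : t ≠ T := fun h => ht (h ▸ hT)
    simpa only [this, if_false] using π.silent t ht ω
  measurable t := by
    by_cases ht : t = T
    · subst ht
      simpa only [if_true] using measurable_encode_some (z := fun ω => expertSignal t ω + c ω)
        ((measurable_expertSignal N t (Finset.mem_Icc.1 (hK hT)).2).add hc)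
    · simpa only [ht, if_false] using π.measurable t

/-- The latest prediction among the periods `t + 1, …, t + n`, with its period. -/
def latest (r : ℕ → Option ℝ) : ℕ → ℕ → Option (ℕ × ℝ)
  | _, 0 => none
  | t, n + 1 =>
    match r (t + 1) with
    | some z => some (t + 1, z)
    | none => latest r (t + 1) n

/-- The variance of the expert's distribution of the outcome at period `t`. -/
noncomputable def expertVar (q : ℝ) (t : ℕ) : ℝ := (1 - q) * t

/-- The variance of the market's distribution at period `t`, when the latest prediction was at
period `T > t`. -/
noncomputable def marketVar (q : ℝ) (T t : ℕ) : ℝ := 1 / (1 / t + q / (1 - q) * (1 / T))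

/-- The mean of the market's distribution at period `t`, when the latest prediction announced `z`
at period `T > t`, and the market signals at `T`, `t` were `xT`, `xt`. -/
noncomputable def marketMean (q : ℝ) (T t : ℕ) (z xT xt : ℝ) : ℝ :=
  (xt / t + 1 / (1 - q) * (z / T) - xT / T) / (1 / t + q / (1 - q) * (1 / T))

/-- The market's distribution (as a density) at period `t`, given its signals and the latest
prediction before `t`, if any, taken at face value. -/
noncomputable def faceValueBefore (q : ℝ) (N t : ℕ) (x : ℕ → ℝ) (r : ℕ → Option ℝ) : ℝ → ℝ :=
  match latest r t (N - t) with
  | none => gaussianPDFReal (x t) t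
  | some (T, z) => gaussianPDFReal (marketMean q T t z (x T) (x t)) (marketVar q T t).toNNReal

theorem latest_congr {r r' : ℕ → Option ℝ} (n t : ℕ) (h : ∀ i ∈ Finset.Ioc t (t + n), r i = r' i) :
    latest r t n = latest r' t n := by
  induction n generalizing t with
  | zero => rfl
  | succ n ih =>
    rw [latest, latest, h (t + 1) (by simp), ih (t + 1) fun i hi => h i (by
      simp only [Finset.mem_Ioc] at hi ⊢; omega)]

theorem latest_mem {r : ℕ → Option ℝ} {T : ℕ} {z : ℝ} (n t : ℕ) (h : latest r t n = some (T, z)) :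
    T ∈ Finset.Ioc t (t + n) := by
  induction n generalizing t with
  | zero => simp [latest] at h
  | succ n ih =>
    rw [latest] at h
    cases hr : r (t + 1) with
    | none =>
      rw [hr] at h
      have := ih (t + 1) h
      simp only [Finset.mem_Ioc] at this ⊢; omega
    | some w =>
      rw [hr] at h
      simp only [Option.some.injEq, Prod.mk.injEq] at h
      simp only [Finset.mem_Ioc]; omega

theorem faceValueBefore_congr (q : ℝ) (N t : ℕ) (x x' : ℕ → ℝ) (r r' : ℕ → Option ℝ) (ht : t ≤ N)
    (hx : ∀ i ∈ Finset.Icc t N, x i = x' i) (hr : ∀ i ∈ Finset.Ioc t N, r i = r' i) :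
    faceValueBefore q N t x r = faceValueBefore q N t x' r' := by
  have hl : latest r t (N - t) = latest r' t (N - t) :=
    latest_congr _ _ (by rwa [Nat.add_sub_cancel' ht])
  have hxt := hx t (by simp [ht])
  unfold faceValueBefore
  rw [← hl, hxt]
  cases h : latest r t (N - t) with
  | none => rfl
  | some p =>
    obtain ⟨T, z⟩ := p
    have hT := latest_mem _ _ h
    have : x T = x' T := hx T (by simp only [Finset.mem_Ioc, Finset.mem_Icc] at hT ⊢; omega)
    simp only [this]

/-- The market that takes the expert's predictions at face value: an announcement is taken for the
expert's signal. -/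
noncomputable def faceValue (q : ℝ) (N : ℕ) : MarketRule N where
  before := faceValueBefore q N
  after t x r :=
    match r t with
    | some z => gaussianPDFReal z (expertVar q t).toNNReal
    | none => faceValueBefore q N t x r
  before_adapted := faceValueBefore_congr q N
  after_adapted t x x' r r' ht hx hr := by
    have h : faceValueBefore q N t x r = faceValueBefore q N t x' r' :=
      faceValueBefore_congr q N t x x' r r' ht hx fun i hi => hr i (Finset.Ioc_subset_Icc_self hi)
    simp only [hr t (by simp [ht]), h]

/-! Given `X_N = x`, all signals are `x` minus linear functionals of finitely many independent
Gaussian steps, so independence is a matter of zero covariances. The basic computation concerns the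
market signals up to `t` and the expert's signals up to `k ≥ t`. For `u ≤ t` the error of the best
linear prediction of `X_u` is independent of all this information (`indep_predError`) and has an
explicit normal law (`map_predError`). Taking `u = 0` gives every posterior needed when a prediction
has been made. The public information is smaller than the joint information but contains the
posterior mean, which is enough.

Optimality is delicate because a false prediction also changes the reference density of the next
one. The way out is to describe the market by a state: the precision and the precision-weighted mean
that the latest prediction adds to the public signal. The state changes only at a prediction, and
each reward, silence included, is a difference of two log densities in consecutive states at the
same period (`reward_faceValue`). Summation by parts pairs the densities in one state at consecutive
periods instead. By Bayes' rule, that pair is the log likelihood which the market assigns to the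
next public signal, plus a term free of the state (`logScore_sub_logScore`). Hence the difference of
the total rewards of two policies is a sum of log likelihood ratios for the one-step forecasts of
the public signal (`rewardFrom_sub_rewardFrom`).

Each summand can be treated alone. If the truthful policy last predicted at `k`, no policy can have
predicted since, so the rival state is known to the expert at `k`. The truthful state gives the
correct conditional law of the next signal given the joint information
(`sub_nextMean_eq_predError`), and Gibbs' inequality makes the conditional expectation of the gain
nonnegative (`condExp_logLikelihoodRatio_nonneg`). Since every gain has an integrable lower bound,
integrability of the negative part of a rival reward suffices for integrability of all terms.

For a single misreport, only two log densities change: the one just after the prediction at `T` and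
the one just before the next prediction. Shifting the mean changes a Gaussian log density by a term
linear in the prediction error and a deterministic multiple of `c ^ 2`. The linear terms have
conditional expectation zero by independence. The sign comes from the market variance being no
larger than the expert's variance at `T`. -/

/-! ### Linear functionals of the steps -/

/-- The individual steps: `inl j` is `A_j`, `inr j` is `B_j`. -/
def step (i : ℕ ⊕ ℕ) (ab : (ℕ → ℝ) × (ℕ → ℝ)) : ℝ := Sum.elim ab.1 ab.2 i

/-- The variances of the individual steps. -/
def stepVar (q : ℝ) : ℕ ⊕ ℕ → ℝ := Sum.elim (fun _ => q) (fun _ => 1 - q)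

/-- The linear functional with weights `w` of the steps `1, …, N`. -/
def noise (N : ℕ) (w : ℕ ⊕ ℕ → ℝ) (ab : (ℕ → ℝ) × (ℕ → ℝ)) : ℝ :=
  ∑ i ∈ (Finset.Icc 1 N).disjSum (Finset.Icc 1 N), w i * step i ab

@[fun_prop]
theorem measurable_step (i : ℕ ⊕ ℕ) : Measurable (step i) := by
  rcases i with i | i
  exacts [(measurable_pi_apply i).comp measurable_fst, (measurable_pi_apply i).comp measurable_snd]

@[fun_prop]
theorem measurable_noise (N : ℕ) (w : ℕ ⊕ ℕ → ℝ) : Measurable (noise N w) := by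
  unfold noise; fun_prop

theorem noise_add (N : ℕ) (w w' : ℕ ⊕ ℕ → ℝ) (ab) :
    noise N (fun i => w i + w' i) ab = noise N w ab + noise N w' ab := by
  simp only [noise, add_mul, Finset.sum_add_distrib]

theorem noise_const_mul (N : ℕ) (c : ℝ) (w : ℕ ⊕ ℕ → ℝ) (ab) :
    noise N (fun i => c * w i) ab = c * noise N w ab := by
  simp only [noise, mul_assoc, Finset.mul_sum]

theorem hasGaussianLaw_coord {v : NNReal} (s : Finset ℕ) :
    HasGaussianLaw (fun (a : ℕ → ℝ) (j : s) => a j)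
      (Measure.infinitePi fun _ : ℕ => gaussianReal 0 v) := by
  refine iIndepFun.hasGaussianLaw (X := fun (j : s) (a : ℕ → ℝ) => a j) (fun j => ?_) ?_
  · constructor
    rw [show (fun a : ℕ → ℝ => a j) = Function.eval (j : ℕ) from rfl, Measure.infinitePi_map_eval]
    infer_instance
  · exact (iIndepFun_infinitePi (P := fun _ : ℕ => gaussianReal 0 v)
      (X := fun _ x => x) (fun _ => measurable_id)).precomp Subtype.val_injective

theorem hasGaussianLaw_steps (q : ℝ) (s : Finset ℕ) :
    HasGaussianLaw (fun (ab : (ℕ → ℝ) × (ℕ → ℝ)) =>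
      ((fun j : s => ab.1 j), (fun j : s => ab.2 j))) (stepLaw q) := by
  refine IndepFun.hasGaussianLaw ?_ ?_
    (indepFun_prod (X := fun (a : ℕ → ℝ) (j : s) => a j) (Y := fun (b : ℕ → ℝ) (j : s) => b j)
      (by fun_prop) (by fun_prop))
  · constructor
    have := (hasGaussianLaw_coord (v := q.toNNReal) s).isGaussian_map
    have h := Measure.map_map (μ := stepLaw q) (g := fun (a : ℕ → ℝ) (j : s) => a j)
      (f := Prod.fst) (by fun_prop) measurable_fst
    rw [stepLaw, Measure.map_fst_prod, measure_univ, one_smul] at h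
    rw [stepLaw]
    exact h ▸ this
  · constructor
    have := (hasGaussianLaw_coord (v := (1 - q).toNNReal) s).isGaussian_map
    have h := Measure.map_map (μ := stepLaw q) (g := fun (a : ℕ → ℝ) (j : s) => a j)
      (f := Prod.snd) (by fun_prop) measurable_snd
    rw [stepLaw, Measure.map_snd_prod, measure_univ, one_smul] at h
    rw [stepLaw]
    exact h ▸ this

/-- Any finite family of functionals is a linear image of the finite vector of steps `1, …, N`,
which is jointly Gaussian. Indexing the process by all weights lets one statement cover signals and
prediction errors alike. -/
theorem isGaussianProcess_noise (q : ℝ) (N : ℕ) : IsGaussianProcess (noise N) (stepLaw q) where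
  hasGaussianLaw I := by
    let L : ((Finset.Icc 1 N → ℝ) × (Finset.Icc 1 N → ℝ)) →ₗ[ℝ] (I → ℝ) :=
      { toFun := fun p w => ∑ j : Finset.Icc 1 N, (w.1 (.inl j) * p.1 j + w.1 (.inr j) * p.2 j)
        map_add' := fun p p' => by
          ext w; simp only [Prod.fst_add, Prod.snd_add, Pi.add_apply, ← Finset.sum_add_distrib]
          exact Finset.sum_congr rfl fun j _ => by ring
        map_smul' := fun c p => by
          ext w; simp only [Prod.smul_fst, Prod.smul_snd, Pi.smul_apply, smul_eq_mul,
            Finset.mul_sum, RingHom.id_apply]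
          exact Finset.sum_congr rfl fun j _ => by ring }
    have h := (hasGaussianLaw_steps q (Finset.Icc 1 N)).map (LinearMap.toContinuousLinearMap L)
    have e : (fun ab => I.restrict (noise N · ab)) = LinearMap.toContinuousLinearMap L ∘
        fun ab : (ℕ → ℝ) × (ℕ → ℝ) => ((fun j : Finset.Icc 1 N => ab.1 j), fun j => ab.2 j) := by
      funext ab
      funext w
      simp only [Finset.restrict, noise, Finset.sum_disjSum, ← Finset.sum_add_distrib]
      exact (Finset.sum_coe_sort (Finset.Icc 1 N)
        fun j => (w : ℕ ⊕ ℕ → ℝ) (.inl j) * ab.1 j + (w : ℕ ⊕ ℕ → ℝ) (.inr j) * ab.2 j).symm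
    exact e ▸ h

theorem map_step_inl (q : ℝ) (j : ℕ) :
    (stepLaw q).map (step (.inl j)) = gaussianReal 0 q.toNNReal := by
  have h := Measure.map_map (μ := stepLaw q) (g := Function.eval j) (f := Prod.fst)
    (measurable_pi_apply j) measurable_fst
  rw [stepLaw, Measure.map_fst_prod, measure_univ, one_smul, Measure.infinitePi_map_eval] at h
  exact h.symm

theorem map_step_inr (q : ℝ) (j : ℕ) :
    (stepLaw q).map (step (.inr j)) = gaussianReal 0 (1 - q).toNNReal := by
  have h := Measure.map_map (μ := stepLaw q) (g := Function.eval j) (f := Prod.snd)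
    (measurable_pi_apply j) measurable_snd
  rw [stepLaw, Measure.map_snd_prod, measure_univ, one_smul, Measure.infinitePi_map_eval] at h
  exact h.symm

theorem map_step {q : ℝ} (i : ℕ ⊕ ℕ) :
    (stepLaw q).map (step i) = gaussianReal 0 (stepVar q i).toNNReal := by
  cases i
  exacts [map_step_inl q _, map_step_inr q _]

theorem memLp_step (q : ℝ) (i : ℕ ⊕ ℕ) : MemLp (step i) 2 (stepLaw q) := by
  have h : MemLp id 2 ((stepLaw q).map (step i)) := by
    rw [map_step]; exact memLp_id_gaussianReal' 2 (by norm_num)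
  exact (memLp_map_measure_iff (by fun_prop) (by fun_prop)).1 h

theorem integral_step (q : ℝ) (i : ℕ ⊕ ℕ) : ∫ ab, step i ab ∂(stepLaw q) = 0 := by
  have h := integral_map (μ := stepLaw q) (φ := step i) (by fun_prop) (f := fun x : ℝ => x)
    (by fun_prop)
  rw [← h, map_step, integral_id_gaussianReal]

theorem variance_step {q : ℝ} (hq0 : 0 ≤ q) (hq1 : q < 1) (i : ℕ ⊕ ℕ) :
    Var[step i; stepLaw q] = stepVar q i := by
  rw [← variance_id_map (by fun_prop), map_step, variance_id_gaussianReal]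
  apply Real.coe_toNNReal
  cases i <;> simp only [stepVar, Sum.elim_inl, Sum.elim_inr] <;> linarith

theorem covariance_step_of_ne (q : ℝ) {i j : ℕ ⊕ ℕ} (h : i ≠ j) :
    cov[step i, step j; stepLaw q] = 0 := by
  have key (v : NNReal) {i j : ℕ} (hij : i ≠ j) : cov[Function.eval i, Function.eval j;
      Measure.infinitePi fun _ : ℕ => gaussianReal 0 v] = 0 := by
    have hm (i : ℕ) : MemLp (Function.eval i) 2
        (Measure.infinitePi fun _ : ℕ => gaussianReal 0 v) := by
      have h : MemLp id 2 ((Measure.infinitePi fun _ : ℕ => gaussianReal 0 v).map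
          (Function.eval i)) := by
        rw [Measure.infinitePi_map_eval]; exact memLp_id_gaussianReal' 2 (by norm_num)
      exact (memLp_map_measure_iff measurable_id.aestronglyMeasurable
        (measurable_pi_apply i).aemeasurable).1 h
    exact ((iIndepFun_infinitePi (P := fun _ : ℕ => gaussianReal 0 v)
      (X := fun _ x => x) (fun _ => measurable_id)).indepFun hij).covariance_eq_zero (hm i) (hm j)
  rcases i with i | i <;> rcases j with j | j
  · have h1 := covariance_map (μ := stepLaw q) (Z := Prod.fst)
      (measurable_pi_apply i).aestronglyMeasurable (measurable_pi_apply j).aestronglyMeasurable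
      measurable_fst.aemeasurable
    rw [stepLaw, Measure.map_fst_prod, measure_univ, one_smul] at h1
    exact h1.symm.trans (key _ (by simpa using h))
  · exact (indepFun_prod (measurable_pi_apply i) (measurable_pi_apply j)).covariance_eq_zero
      (memLp_step q (.inl i)) (memLp_step q (.inr j))
  · exact (indepFun_prod (measurable_pi_apply j) (measurable_pi_apply i)).symm.covariance_eq_zero
      (memLp_step q (.inr i)) (memLp_step q (.inl j))
  · have h1 := covariance_map (μ := stepLaw q) (Z := Prod.snd)
      (measurable_pi_apply i).aestronglyMeasurable (measurable_pi_apply j).aestronglyMeasurable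
      measurable_snd.aemeasurable
    rw [stepLaw, Measure.map_snd_prod, measure_univ, one_smul] at h1
    exact h1.symm.trans (key _ (by simpa using h))

theorem covariance_noise {q : ℝ} (hq0 : 0 ≤ q) (hq1 : q < 1) (N : ℕ) (w w' : ℕ ⊕ ℕ → ℝ) :
    cov[noise N w, noise N w'; stepLaw q] =
      ∑ j ∈ Finset.Icc 1 N,
        (q * w (.inl j) * w' (.inl j) + (1 - q) * w (.inr j) * w' (.inr j)) := by
  unfold noise
  rw [covariance_fun_sum_fun_sum' (fun i _ => (memLp_step q i).const_mul _)
    (fun i _ => (memLp_step q i).const_mul _)]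
  have h : ∀ i ∈ (Finset.Icc 1 N).disjSum (Finset.Icc 1 N),
      ∑ j ∈ (Finset.Icc 1 N).disjSum (Finset.Icc 1 N),
        cov[fun ab => w i * step i ab, fun ab => w' j * step j ab; stepLaw q] =
      stepVar q i * w i * w' i := fun i hi => by
    rw [Finset.sum_eq_single_of_mem i hi]
    · rw [covariance_const_mul_left, covariance_const_mul_right, covariance_self (by fun_prop),
        variance_step hq0 hq1]
      ring
    · intro j _ hj
      rw [covariance_const_mul_left, covariance_const_mul_right,
        covariance_step_of_ne q hj.symm]
      ring
  rw [Finset.sum_congr rfl h, Finset.sum_disjSum, ← Finset.sum_add_distrib]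
  rfl

theorem integral_noise (q : ℝ) (N : ℕ) (w : ℕ ⊕ ℕ → ℝ) :
    ∫ ab, noise N w ab ∂(stepLaw q) = 0 := by
  unfold noise
  rw [integral_finsetSum _ fun i _ => ((memLp_step q i).integrable one_le_two).const_mul _]
  simp [integral_const_mul, integral_step]

theorem map_noise {q : ℝ} (hq0 : 0 ≤ q) (hq1 : q < 1) (N : ℕ) (w : ℕ ⊕ ℕ → ℝ) :
    (stepLaw q).map (noise N w) = gaussianReal 0
      (∑ j ∈ Finset.Icc 1 N, (q * w (.inl j) ^ 2 + (1 - q) * w (.inr j) ^ 2)).toNNReal := by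
  rw [((isGaussianProcess_noise q N).hasGaussianLaw_eval w).map_eq_gaussianReal, integral_noise,
    ← covariance_self (by fun_prop), covariance_noise hq0 hq1]
  congr 2
  exact Finset.sum_congr rfl fun j _ => by ring

/-- In a Gaussian process, pairwise zero covariance gives independence of whole subfamilies. The set
`S` may be infinite, so it can be taken to consist of everything uncorrelated with `w`. -/
theorem indepFun_noise {q : ℝ} (N : ℕ) (w : ℕ ⊕ ℕ → ℝ) (S : Set (ℕ ⊕ ℕ → ℝ))
    (h : ∀ w' ∈ S, cov[noise N w, noise N w'; stepLaw q] = 0) :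
    IndepFun (fun ab (w' : S) => noise N w' ab) (noise N w) (stepLaw q) := by
  have := IsGaussianProcess.indepFun_of_covariance_eq_zero
    (X := fun w' : S => noise N w') (Y := fun _ : Unit => noise N w) (P := stepLaw q)
    (by
      have e : Sum.elim (fun w' : S => noise N w') (fun _ : Unit => noise N w) =
          noise N ∘ Sum.elim (fun w' : S => (w' : ℕ ⊕ ℕ → ℝ)) fun _ : Unit => w := by
        funext i; cases i <;> rfl
      exact e ▸ (isGaussianProcess_noise q N).comp_right _)
    (fun _ => by fun_prop) (fun _ => by fun_prop)
    (fun w' _ => by rw [covariance_comm]; exact h w' w'.2)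
  exact this.comp measurable_id (measurable_pi_apply ())

/-! ### The signals as linear functionals of the steps -/

@[fun_prop]
theorem measurable_marketSignal (t : ℕ) : Measurable (marketSignal t) := by
  unfold marketSignal; fun_prop

@[fun_prop]
theorem measurable_expertSignal' (t : ℕ) : Measurable (expertSignal t) := by
  unfold expertSignal; fun_prop

/-- The weights of the steps in `x - X_i`. -/
def marketWeight (i : ℕ) : ℕ ⊕ ℕ → ℝ :=
  Sum.elim (fun j => if i < j then 1 else 0) fun j => if i < j then 1 else 0

/-- The weights of the steps in `x - Y_i`. -/
def expertWeight (i : ℕ) : ℕ ⊕ ℕ → ℝ :=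
  Sum.elim (fun _ => 1) fun j => if i < j then 1 else 0

theorem sum_Icc_sub_ite (f : ℕ → ℝ) {i N : ℕ} (hi : i ≤ N) :
    ∑ j ∈ Finset.Icc 1 N, f j - ∑ j ∈ Finset.Icc 1 N, (if i < j then 1 else 0) * f j =
      ∑ j ∈ Finset.Icc 1 i, f j := by
  rw [← Finset.sum_sub_distrib]
  have hs : Finset.Icc 1 i ⊆ Finset.Icc 1 N := Finset.Icc_subset_Icc_right hi
  rw [← Finset.sum_subset hs (f := fun j => f j - (if i < j then 1 else 0) * f j)]
  · refine Finset.sum_congr rfl fun j hj => ?_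
    rw [if_neg (by simp only [Finset.mem_Icc] at hj; omega)]; ring
  · intro j hj hj'
    rw [if_pos (by simp only [Finset.mem_Icc] at hj hj'; omega)]; ring

theorem marketSignal_worldFrom {N i : ℕ} (hi : i ≤ N) (x : ℝ) (ab) :
    marketSignal i (worldFrom N x ab) = x - noise N (marketWeight i) ab := by
  simp only [marketSignal, worldFrom, noise, Finset.sum_disjSum, marketWeight, step, Sum.elim_inl,
    Sum.elim_inr, ← sum_Icc_sub_ite _ hi, mul_add, Finset.sum_add_distrib]
  ring

theorem expertSignal_worldFrom {N i : ℕ} (hi : i ≤ N) (x : ℝ) (ab) :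
    expertSignal i (worldFrom N x ab) = x - noise N (expertWeight i) ab := by
  simp only [expertSignal, worldFrom, noise, Finset.sum_disjSum, expertWeight, step, Sum.elim_inl,
    Sum.elim_inr, Finset.sum_add_distrib, ← sum_Icc_sub_ite _ hi, one_mul]
  ring

/-- What is known from the expert's signals up to period `k` and the market signals up to
period `t`. -/
@[reducible]
def jointInfo (N k t : ℕ) : MeasurableSpace World :=
  expertInfo N k ⊔ ⨆ i ∈ Finset.Icc t N, MeasurableSpace.comap (marketSignal i) inferInstance

theorem expertInfo_le (N t : ℕ) : expertInfo N t ≤ Prod.instMeasurableSpace :=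
  iSup₂_le fun i _ => sup_le (measurable_marketSignal i).comap_le
    (measurable_expertSignal' i).comap_le

theorem jointInfo_le (N k t : ℕ) : jointInfo N k t ≤ Prod.instMeasurableSpace :=
  sup_le (expertInfo_le N k) (iSup₂_le fun i _ => (measurable_marketSignal i).comap_le)

theorem expertInfo_anti {N s t : ℕ} (h : s ≤ t) : expertInfo N t ≤ expertInfo N s :=
  biSup_mono fun i hi => by simp only [Finset.mem_Icc] at hi ⊢; omega

theorem measurable_marketSignal_expertInfo {N i t : ℕ} (hi : t ≤ i) (hN : i ≤ N) :
    Measurable[expertInfo N t] (marketSignal i) := by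
  have h : MeasurableSpace.comap (marketSignal i) inferInstance ≤ expertInfo N t :=
    le_sup_left.trans (le_iSup₂_of_le (f := fun i (_ : i ∈ Finset.Icc t N) =>
      MeasurableSpace.comap (marketSignal i) inferInstance ⊔
        MeasurableSpace.comap (expertSignal i) inferInstance) i (by simp [hi, hN]) le_rfl)
  exact (comap_measurable (marketSignal i)).mono h le_rfl

theorem measurable_marketSignal_jointInfo {N k i t : ℕ} (hi : t ≤ i) (hN : i ≤ N) :
    Measurable[jointInfo N k t] (marketSignal i) := by
  have h : MeasurableSpace.comap (marketSignal i) inferInstance ≤ jointInfo N k t :=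
    (le_iSup₂_of_le (f := fun i (_ : i ∈ Finset.Icc t N) =>
      MeasurableSpace.comap (marketSignal i) inferInstance) i (by simp [hi, hN]) le_rfl).trans
      le_sup_right
  exact (comap_measurable (marketSignal i)).mono h le_rfl

theorem expertInfo_le_jointInfo (N k t : ℕ) : expertInfo N k ≤ jointInfo N k t := le_sup_left

/-- The hypotheses on `w` are zero covariances with the signals that generate the information. The
public signal at `i` sees both steps `j > i`, so cancellation step by step beyond `t` is enough. The
expert signal at `i` sees every `A_j` but only the `B_j` with `j > i`, whence the condition on sums.
-/
theorem indep_jointInfo_of_weight {q : ℝ} (hq0 : 0 ≤ q) (hq1 : q < 1) {N k t : ℕ} (htk : t ≤ k) (x : ℝ)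
    {D : World → ℝ} (hD : Measurable D) {w : ℕ ⊕ ℕ → ℝ}
    (hw : ∀ ab, D (worldFrom N x ab) = noise N w ab)
    (hm : ∀ j, t < j → j ≤ N → q * w (.inl j) + (1 - q) * w (.inr j) = 0)
    (he : ∀ i ∈ Finset.Icc k N, ∑ j ∈ Finset.Icc 1 N,
      (q * w (.inl j) + if i < j then (1 - q) * w (.inr j) else 0) = 0) :
    Indep (jointInfo N k t) (MeasurableSpace.comap D inferInstance) (worldLaw q N x) := by
  let S : Set (ℕ ⊕ ℕ → ℝ) := {w' | cov[noise N w, noise N w'; stepLaw q] = 0}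
  have hind := indepFun_noise (q := q) N w S fun w' hw' => hw'
  rw [IndepFun_iff_Indep] at hind
  let F : (ℕ → ℝ) × (ℕ → ℝ) → S → ℝ := fun ab w' => noise N w' ab
  have hF (w' : S) : Measurable[MeasurableSpace.comap F inferInstance] (noise N w') :=
    (measurable_pi_apply w').comp (comap_measurable F)
  have hmarket : ∀ i ∈ Finset.Icc t N, marketWeight i ∈ S := fun i hi => by
    change cov[_, _; _] = 0
    rw [covariance_noise hq0 hq1]
    refine Finset.sum_eq_zero fun j hj => ?_
    simp only [Finset.mem_Icc] at hi hj
    by_cases hij : i < j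
    · simp [marketWeight, hij, hm j (by omega) hj.2]
    · simp [marketWeight, hij]
  have hexpert : ∀ i ∈ Finset.Icc k N, expertWeight i ∈ S := fun i hi => by
    change cov[_, _; _] = 0
    rw [covariance_noise hq0 hq1, ← he i hi]
    exact Finset.sum_congr rfl fun j _ => by simp [expertWeight]
  have hle : (jointInfo N k t).comap (worldFrom N x) ≤ MeasurableSpace.comap F inferInstance := by
    simp only [jointInfo, expertInfo, MeasurableSpace.comap_sup, MeasurableSpace.comap_iSup,
      MeasurableSpace.comap_comp]
    refine sup_le (iSup₂_le fun i hi => sup_le ?_ ?_) (iSup₂_le fun i hi => ?_)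
    · refine Measurable.comap_le ?_
      rw [show marketSignal i ∘ worldFrom N x = fun ab => x - noise N (marketWeight i) ab from
        funext fun ab => marketSignal_worldFrom (Finset.mem_Icc.1 hi).2 x ab]
      exact measurable_const.sub (hF ⟨_, hmarket i (Finset.Icc_subset_Icc_left htk hi)⟩)
    · refine Measurable.comap_le ?_
      rw [show expertSignal i ∘ worldFrom N x = fun ab => x - noise N (expertWeight i) ab from
        funext fun ab => expertSignal_worldFrom (Finset.mem_Icc.1 hi).2 x ab]
      exact measurable_const.sub (hF ⟨_, hexpert i hi⟩)
    · refine Measurable.comap_le ?_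
      rw [show marketSignal i ∘ worldFrom N x = fun ab => x - noise N (marketWeight i) ab from
        funext fun ab => marketSignal_worldFrom (Finset.mem_Icc.1 hi).2 x ab]
      exact measurable_const.sub (hF ⟨_, hmarket i hi⟩)
  rw [Indep_iff] at hind ⊢
  rintro s _ hs ⟨s', hs', rfl⟩
  have hs0 := jointInfo_le N k t s hs
  rw [worldLaw, Measure.map_apply (measurable_worldFrom N x) (hs0.inter (hD hs')),
    Measure.map_apply (measurable_worldFrom N x) hs0,
    Measure.map_apply (measurable_worldFrom N x) (hD hs')]
  have e : worldFrom N x ⁻¹' (D ⁻¹' s') = noise N w ⁻¹' s' := by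
    ext ab; simp only [Set.mem_preimage, hw]
  rw [Set.preimage_inter, e]
  exact hind _ _ (hle _ ⟨s, hs, rfl⟩) ⟨s', hs', rfl⟩

theorem map_eq_gaussianReal_of_weight {q : ℝ} (hq0 : 0 ≤ q) (hq1 : q < 1) {N : ℕ} (x : ℝ)
    {D : World → ℝ} (hD : Measurable D) {w : ℕ ⊕ ℕ → ℝ}
    (hw : ∀ ab, D (worldFrom N x ab) = noise N w ab) :
    (worldLaw q N x).map D = gaussianReal 0
      (∑ j ∈ Finset.Icc 1 N, (q * w (.inl j) ^ 2 + (1 - q) * w (.inr j) ^ 2)).toNNReal := by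
  rw [worldLaw, Measure.map_map hD (measurable_worldFrom N x), ← map_noise hq0 hq1]
  exact congrArg (fun f => (stepLaw q).map f) (funext hw)

/-- Prediction errors have weights that are constant on the blocks cut out by `u ≤ t ≤ k`, and zero
beyond `k`; this reduces their covariances and variances to polynomial identities. -/
theorem sum_Icc_of_piecewise {f : ℕ → ℝ} {u t k N : ℕ} {a b c : ℝ} (hut : u ≤ t) (htk : t ≤ k)
    (hkN : k ≤ N) (ha : ∀ j, 1 ≤ j → j ≤ u → f j = a) (hb : ∀ j, u < j → j ≤ t → f j = b)
    (hc : ∀ j, t < j → j ≤ k → f j = c) (h0 : ∀ j, k < j → j ≤ N → f j = 0) :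
    ∑ j ∈ Finset.Icc 1 N, f j = u * a + (t - u) * b + (k - t) * c := by
  rw [show Finset.Icc 1 N = Finset.Ioc 0 N from rfl,
    ← Finset.sum_Ioc_consecutive f (Nat.zero_le k) hkN,
    ← Finset.sum_Ioc_consecutive f (Nat.zero_le t) htk,
    ← Finset.sum_Ioc_consecutive f (Nat.zero_le u) hut]
  have e {m n : ℕ} {d : ℝ} (hmn : m ≤ n) (h : ∀ j, m < j → j ≤ n → f j = d) :
      ∑ j ∈ Finset.Ioc m n, f j = (n - m) * d := by
    rw [Finset.sum_congr rfl fun j hj => h j (Finset.mem_Ioc.1 hj).1 (Finset.mem_Ioc.1 hj).2,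
      Finset.sum_const, Nat.card_Ioc, nsmul_eq_mul, Nat.cast_sub hmn]
  rw [e (Nat.zero_le u) fun j h1 h2 => ha j h1 h2, e hut hb, e htk hc, e hkN h0]
  push_cast; ring

/-! ### Best linear prediction of later public signals -/

/-- The denominator `(1 - q) k + q t` of the market's precision at period `t`, when the latest
prediction was at period `k`, in units of `1 / ((1 - q) k t)`. -/
def precDenom (q : ℝ) (k t : ℕ) : ℝ := (1 - q) * k + q * t

theorem precDenom_pos {q : ℝ} (hq0 : 0 ≤ q) (hq1 : q < 1) {k : ℕ} (hk : 1 ≤ k) (t : ℕ) :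
    0 < precDenom q k t := by
  have : (0 : ℝ) < k := by exact_mod_cast hk
  have : 0 < (1 - q) * k := mul_pos (by linarith) this
  unfold precDenom
  positivity

/-- The error of the best prediction of `X_u` at period `t`, given the market signals up to `t` and
the expert's signals up to `k`. -/
noncomputable def predError (q : ℝ) (k t u : ℕ) (ω : World) : ℝ :=
  marketSignal u ω - (precDenom q k u * marketSignal t ω +
    (t - u) * (expertSignal k ω - (1 - q) * marketSignal k ω)) / precDenom q k t

@[fun_prop]
theorem measurable_predError (q : ℝ) (k t u : ℕ) : Measurable (predError q k t u) := by
  unfold predError; fun_prop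

/-- The weights of the steps in `predError`. -/
noncomputable def predWeight (q : ℝ) (k t u : ℕ) (i : ℕ ⊕ ℕ) : ℝ :=
  -1 * marketWeight u i + (precDenom q k u / precDenom q k t * marketWeight t i +
    ((t - u) / precDenom q k t * expertWeight k i +
      -((1 - q) * (t - u) / precDenom q k t) * marketWeight k i))

theorem predError_worldFrom {q : ℝ} (hq0 : 0 ≤ q) (hq1 : q < 1) {N k t u : ℕ} (x : ℝ)
    (hk : 1 ≤ k) (hut : u ≤ t) (htk : t ≤ k) (hkN : k ≤ N) (ab) :
    predError q k t u (worldFrom N x ab) = noise N (predWeight q k t u) ab := by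
  have he := (precDenom_pos hq0 hq1 hk t).ne'
  unfold predWeight predError
  rw [noise_add, noise_add, noise_add, noise_const_mul, noise_const_mul, noise_const_mul,
    noise_const_mul, marketSignal_worldFrom (by omega), marketSignal_worldFrom (by omega),
    marketSignal_worldFrom hkN, expertSignal_worldFrom hkN]
  field_simp
  unfold precDenom
  ring

/-- Between `t` and `k` the weights of `A` and `B` are in the ratio `1 - q : -q`, so that they are
uncorrelated with the public steps there; beyond `k`, where both parts are known, everything
cancels. -/
theorem predWeight_cases {q : ℝ} (hq0 : 0 ≤ q) (hq1 : q < 1) {k t u : ℕ}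
    (hk : 1 ≤ k) (hut : u ≤ t) (htk : t ≤ k) (j : ℕ) :
    (j ≤ u → predWeight q k t u (.inl j) = (t - u) / precDenom q k t ∧
      predWeight q k t u (.inr j) = 0) ∧
    (u < j → j ≤ t → predWeight q k t u (.inl j) = (t - u) / precDenom q k t - 1 ∧
      predWeight q k t u (.inr j) = -1) ∧
    (t < j → j ≤ k → predWeight q k t u (.inl j) = (1 - q) * ((t - u) / precDenom q k t) ∧
      predWeight q k t u (.inr j) = -q * ((t - u) / precDenom q k t)) ∧
    (k < j → predWeight q k t u (.inl j) = 0 ∧ predWeight q k t u (.inr j) = 0) := by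
  have he := (precDenom_pos hq0 hq1 hk t).ne'
  refine ⟨fun h => ?_, fun h h' => ?_, fun h h' => ?_, fun h => ?_⟩ <;>
    simp only [predWeight, marketWeight, expertWeight, Sum.elim_inl, Sum.elim_inr]
  · simp [show ¬ u < j by omega, show ¬ t < j by omega, show ¬ k < j by omega]
  · simp only [show u < j by omega, show ¬ t < j by omega, show ¬ k < j by omega, if_true, if_false]
    constructor <;> ring
  · simp only [show u < j by omega, show t < j by omega, show ¬ k < j by omega, if_true, if_false]
    constructor <;> field_simp <;> unfold precDenom <;> ring
  · simp only [show u < j by omega, show t < j by omega, show k < j by omega, if_true]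
    constructor <;> field_simp <;> unfold precDenom <;> ring

theorem indep_predError {q : ℝ} (hq0 : 0 ≤ q) (hq1 : q < 1) {N k t u : ℕ} (x : ℝ)
    (hk : 1 ≤ k) (hut : u ≤ t) (htk : t ≤ k) (hkN : k ≤ N) :
    Indep (jointInfo N k t) (MeasurableSpace.comap (predError q k t u) inferInstance)
      (worldLaw q N x) := by
  have hw := predWeight_cases hq0 hq1 hk hut htk
  have he := (precDenom_pos hq0 hq1 hk t).ne'
  refine indep_jointInfo_of_weight hq0 hq1 htk x (by fun_prop)
    (predError_worldFrom hq0 hq1 x hk hut htk hkN) (fun j hj _ => ?_) fun i hi => ?_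
  · rcases le_or_gt j k with hjk | hjk
    · rw [((hw j).2.2.1 hj hjk).1, ((hw j).2.2.1 hj hjk).2]; ring
    · rw [((hw j).2.2.2 hjk).1, ((hw j).2.2.2 hjk).2]; ring
  · have hk' : ∀ j, i < j → predWeight q k t u (.inr j) = 0 := fun j hj =>
      ((hw j).2.2.2 (by simp only [Finset.mem_Icc] at hi; omega)).2
    have hs : ∀ j ∈ Finset.Icc 1 N, (q * predWeight q k t u (.inl j) +
        if i < j then (1 - q) * predWeight q k t u (.inr j) else 0) =
        q * predWeight q k t u (.inl j) := fun j _ => by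
      split_ifs with h
      · rw [hk' j h]; ring
      · ring
    rw [Finset.sum_congr rfl hs, ← Finset.mul_sum, sum_Icc_of_piecewise hut htk hkN
      (fun j _ h => ((hw j).1 h).1) (fun j h h' => ((hw j).2.1 h h').1)
      (fun j h h' => ((hw j).2.2.1 h h').1) (fun j h _ => ((hw j).2.2.2 h).1)]
    -- What remains is that the weights of the `A_j` sum to zero. With slope `(t - u) / precDenom q
    -- k t` the sum is the slope times `t + (1 - q) (k - t) = precDenom q k t`, minus `t - u`; this
    -- is what fixes the denominator.
    field_simp
    unfold precDenom
    ring

theorem map_predError {q : ℝ} (hq0 : 0 ≤ q) (hq1 : q < 1) {N k t u : ℕ} (x : ℝ)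
    (hk : 1 ≤ k) (hut : u ≤ t) (htk : t ≤ k) (hkN : k ≤ N) :
    (worldLaw q N x).map (predError q k t u) =
      gaussianReal 0 ((t - u) * precDenom q k u / precDenom q k t).toNNReal := by
  have hw := predWeight_cases hq0 hq1 hk hut htk
  have he := (precDenom_pos hq0 hq1 hk t).ne'
  rw [map_eq_gaussianReal_of_weight hq0 hq1 x (by fun_prop)
    (predError_worldFrom hq0 hq1 x hk hut htk hkN), sum_Icc_of_piecewise hut htk hkN
    (fun j _ h => by rw [((hw j).1 h).1, ((hw j).1 h).2])
    (fun j h h' => by rw [((hw j).2.1 h h').1, ((hw j).2.1 h h').2])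
    (fun j h h' => by rw [((hw j).2.2.1 h h').1, ((hw j).2.2.1 h h').2])
    (fun j h _ => by rw [((hw j).2.2.2 h).1, ((hw j).2.2.2 h).2]; ring)]
  congr 2
  field_simp
  unfold precDenom
  ring

theorem worldFrom_outcome_sub (N t : ℕ) (ht : t ≤ N) (x : ℝ) (ab) :
    outcome (worldFrom N x ab) - marketSignal t (worldFrom N x ab) =
      noise N (fun i => -1 * marketWeight 0 i + 1 * marketWeight t i) ab := by
  have h0 : outcome (worldFrom N x ab) = marketSignal 0 (worldFrom N x ab) := by
    simp [outcome, marketSignal]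
  rw [noise_add, noise_const_mul, noise_const_mul, h0, marketSignal_worldFrom (Nat.zero_le N),
    marketSignal_worldFrom ht]
  ring

/-- The case without predictions. Taking `k = N + 1` makes the range of expert signals empty, so
`jointInfo N (N + 1) t` contains public signals only. -/
theorem indep_outcome_sub_marketSignal {q : ℝ} (hq0 : 0 ≤ q) (hq1 : q < 1) {N t : ℕ} (x : ℝ)
    (ht : t ≤ N) :
    Indep (jointInfo N (N + 1) t) (MeasurableSpace.comap
      (fun ω => outcome ω - marketSignal t ω) inferInstance) (worldLaw q N x) := by
  refine indep_jointInfo_of_weight hq0 hq1 (by omega) x (by unfold outcome; fun_prop)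
    (worldFrom_outcome_sub N t ht x) (fun j hj _ => ?_) fun i hi => ?_
  · simp [marketWeight, hj, show 0 < j by omega]
  · simp at hi

theorem map_outcome_sub_marketSignal {q : ℝ} (hq0 : 0 ≤ q) (hq1 : q < 1) {N t : ℕ} (x : ℝ)
    (ht : t ≤ N) :
    (worldLaw q N x).map (fun ω => outcome ω - marketSignal t ω) = gaussianReal 0 t := by
  rw [map_eq_gaussianReal_of_weight hq0 hq1 x (by unfold outcome; fun_prop)
    (worldFrom_outcome_sub N t ht x), sum_Icc_of_piecewise (Nat.zero_le t) le_rfl ht (a := 0)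
    (b := 1) (c := 0) (fun j h h' => by omega)
    (fun j h h' => by simp [marketWeight, h, h'.not_gt])
    (fun j h h' => by omega)
    (fun j h _ => by simp [marketWeight, h, show 0 < j by omega])]
  congr 1
  simp

/-! ### Posteriors and conditional expectations from independence -/

theorem gaussianReal_eq_measure_preimage (b : ℝ) (v : NNReal) {s : Set ℝ} (hs : MeasurableSet s) :
    gaussianReal b v s = gaussianReal 0 v ((b + ·) ⁻¹' s) := by
  rw [← Measure.map_apply (measurable_const_add b) hs, gaussianReal_map_const_add, zero_add]

theorem measurable_gaussianReal_apply (v : NNReal) {s : Set ℝ} (hs : MeasurableSet s) :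
    Measurable fun b => gaussianReal b v s := by
  simp only [gaussianReal_eq_measure_preimage _ v hs]
  exact measurable_measure_prodMk_left
    (s := {p : ℝ × ℝ | p.1 + p.2 ∈ s}) (measurable_fst.add measurable_snd hs)

/-- If `f` is a known centre `μ` plus independent noise, conditioning freezes `μ` and leaves the law
of the noise. This is Fubini on the product law of the known part and the noise. -/
theorem condExp_preimage_eq_gaussianReal {Ω : Type*} {m mΩ : MeasurableSpace Ω} {P : Measure Ω}
    [IsProbabilityMeasure P] (hm : m ≤ mΩ) {f μ : Ω → ℝ} {v : NNReal}
    (hf : Measurable f) (hμ : Measurable[m] μ)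
    (hind : Indep m (MeasurableSpace.comap (fun ω => f ω - μ ω) inferInstance) P)
    (hlaw : P.map (fun ω => f ω - μ ω) = gaussianReal 0 v) {s : Set ℝ} (hs : MeasurableSet s) :
    (fun ω => (gaussianReal (μ ω) v).real s) =ᵐ[P] P⟦f ⁻¹' s | m⟧ := by
  have hμ' : Measurable μ := hμ.mono hm le_rfl
  have hD : Measurable fun ω => f ω - μ ω := hf.sub hμ'
  have hgm : Measurable[m] fun ω => gaussianReal (μ ω) v s :=
    (measurable_gaussianReal_apply v hs).comp hμ
  have key : ∀ A, MeasurableSet[m] A →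
      ∫⁻ ω in A, gaussianReal (μ ω) v s ∂P = P (f ⁻¹' s ∩ A) := by
    intro A hA
    -- Pairing the centre with the indicator of `A` encodes integration over `A` as an event about
    -- one `m`-measurable variable.
    let Z : Ω → ℝ × ℝ := fun ω => (A.indicator 1 ω, μ ω)
    have hZ : Measurable[m] Z :=
      (Measurable.indicator (m := m) (measurable_const (a := (1 : ℝ))) hA).prodMk hμ
    have hZ' : Measurable Z := hZ.mono hm le_rfl
    have hI : IndepFun Z (fun ω => f ω - μ ω) P := by
      rw [IndepFun_iff_Indep]
      exact indep_of_indep_of_le_left hind hZ.comap_le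
    let B : Set ((ℝ × ℝ) × ℝ) := {p | p.1.1 = 1 ∧ p.1.2 + p.2 ∈ s}
    have hB : MeasurableSet B :=
      (measurable_fst.fst (measurableSet_singleton 1)).inter
        ((measurable_fst.snd.add measurable_snd) hs)
    have e : (fun ω => (Z ω, f ω - μ ω)) ⁻¹' B = f ⁻¹' s ∩ A := by
      ext ω
      by_cases h : ω ∈ A <;> simp [Z, B, h]
    rw [← e, ← Measure.map_apply (hZ'.prodMk hD) hB,
      (indepFun_iff_map_prod_eq_prod_map_map hZ'.aemeasurable hD.aemeasurable).1 hI, hlaw,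
      Measure.prod_apply hB, lintegral_map (measurable_measure_prodMk_left hB) hZ',
      ← lintegral_indicator (hm A hA)]
    refine lintegral_congr fun ω => ?_
    by_cases h : ω ∈ A
    · simp [Z, B, h, gaussianReal_eq_measure_preimage (μ ω) v hs, Set.preimage]
    · simp [Z, B, h]
  refine ae_eq_condExp_of_forall_setIntegral_eq hm
    ((integrable_const 1).indicator (hf hs)) (fun A _ _ => ?_) (fun A hA _ => ?_) ?_
  · refine Integrable.integrableOn (Integrable.of_bound (C := 1)
      (hgm.mono hm le_rfl).ennreal_toReal.aestronglyMeasurable (Filter.Eventually.of_forall ?_))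
    intro ω
    rw [Real.norm_of_nonneg measureReal_nonneg]
    exact measureReal_le_one
  · rw [setIntegral_indicator (hf hs), setIntegral_const, smul_eq_mul, mul_one, Set.inter_comm]
    simp only [measureReal_def]
    rw [integral_toReal (hgm.mono hm le_rfl).aemeasurable
      (Filter.Eventually.of_forall fun ω => measure_lt_top _ _), key A hA]
  · exact hgm.ennreal_toReal.aestronglyMeasurable

@[fun_prop]
theorem measurable_outcome : Measurable outcome := measurable_fst

/-- The identity for a single set holds only almost surely. Half-lines with rational endpoints form
a countable π-system generating the Borel sets, so one null set serves for the whole measure. -/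
theorem map_condExpKernel_eq_gaussianReal {Ω : Type*} {m : MeasurableSpace Ω}
    [mΩ : MeasurableSpace Ω] [StandardBorelSpace Ω] {P : Measure Ω}
    [IsProbabilityMeasure P] (hm : m ≤ mΩ) {f μ : Ω → ℝ} {v : NNReal}
    (hf : Measurable f) (hμ : Measurable[m] μ)
    (hind : Indep m (MeasurableSpace.comap (fun ω => f ω - μ ω) inferInstance) P)
    (hlaw : P.map (fun ω => f ω - μ ω) = gaussianReal 0 v) :
    ∀ᵐ ω ∂P, (condExpKernel P m ω).map f = gaussianReal (μ ω) v := by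
  have h : ∀ᵐ ω ∂P, ∀ a : ℚ, (condExpKernel P m ω).real (f ⁻¹' Set.Iic (a : ℝ)) =
      (gaussianReal (μ ω) v).real (Set.Iic (a : ℝ)) := by
    refine ae_all_iff.2 fun a => ?_
    filter_upwards [condExpKernel_ae_eq_condExp hm (hf measurableSet_Iic) (μ := P),
      condExp_preimage_eq_gaussianReal hm hf hμ hind hlaw (measurableSet_Iic (a := (a : ℝ)))]
      with ω h1 h2
    rw [h1, ← h2]
  filter_upwards [h] with ω hω
  have : IsProbabilityMeasure ((condExpKernel P m ω).map f) :=
    Measure.isProbabilityMeasure_map hf.aemeasurable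
  refine ext_of_generate_finite _ (Real.borel_eq_generateFrom_Iic_rat ▸ BorelSpace.measurable_eq)
    Real.isPiSystem_Iic_rat ?_ (by simp)
  intro s hs
  simp only [Set.mem_iUnion, Set.mem_singleton_iff] at hs
  obtain ⟨a, rfl⟩ := hs
  rw [Measure.map_apply hf measurableSet_Iic]
  exact (measureReal_eq_measureReal_iff (by finiteness) (by finiteness)).1 (hω a)

/-- Known factors come out of the conditional expectation, and the independent factor has mean zero.
This removes all linear and centred quadratic terms in prediction errors below. -/
theorem condExp_mul_comp_eq_zero {Ω : Type*} {m mΩ : MeasurableSpace Ω} {P : Measure Ω}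
    [IsProbabilityMeasure P] (hm : m ≤ mΩ) {D h : Ω → ℝ} {g : ℝ → ℝ}
    (hD : Measurable D) (hind : Indep m (MeasurableSpace.comap D inferInstance) P)
    (hh : Measurable[m] h) (hg : Measurable g) (hgD : Integrable (fun ω => g (D ω)) P)
    (hz : ∫ ω, g (D ω) ∂P = 0) (hi : Integrable (fun ω => h ω * g (D ω)) P) :
    P[fun ω => h ω * g (D ω) | m] =ᵐ[P] 0 := by
  have h1 := condExp_mul_of_stronglyMeasurable_left (m := m) (μ := P) (f := h)
    (g := fun ω => g (D ω)) hh.stronglyMeasurable hi hgD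
  have h2 := condExp_indep_eq (m₁ := MeasurableSpace.comap D inferInstance) (m₂ := m) (μ := P)
    hD.comap_le hm (f := fun ω => g (D ω)) (hg.comp (comap_measurable D)).stronglyMeasurable
    hind.symm
  filter_upwards [h1, h2] with ω h1 h2
  refine h1.trans ?_
  rw [Pi.mul_apply, h2, hz, mul_zero, Pi.zero_apply]

theorem memLp_two_of_map_gaussianReal {Ω : Type*} {mΩ : MeasurableSpace Ω} {P : Measure Ω}
    {D : Ω → ℝ} (hD : Measurable D) {b : ℝ} {v : NNReal} (h : P.map D = gaussianReal b v) :
    MemLp D 2 P := by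
  have h' : MemLp id 2 (P.map D) := by
    rw [h]; exact memLp_id_gaussianReal' 2 (by norm_num)
  exact (memLp_map_measure_iff measurable_id.aestronglyMeasurable hD.aemeasurable).1 h'

theorem integral_eq_zero_of_map_gaussianReal {Ω : Type*} {mΩ : MeasurableSpace Ω} {P : Measure Ω}
    {D : Ω → ℝ} (hD : Measurable D) {v : NNReal} (h : P.map D = gaussianReal 0 v) :
    ∫ ω, D ω ∂P = 0 := by
  have h' := integral_map (μ := P) hD.aemeasurable (f := fun x : ℝ => x) (by fun_prop)
  rw [← h', h, integral_id_gaussianReal]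

theorem integral_sq_eq_of_map_gaussianReal {Ω : Type*} {mΩ : MeasurableSpace Ω} {P : Measure Ω}
    {D : Ω → ℝ} (hD : Measurable D) {v : NNReal} (h : P.map D = gaussianReal 0 v) :
    ∫ ω, D ω ^ 2 ∂P = v := by
  have h' := integral_map (μ := P) hD.aemeasurable (f := fun x : ℝ => x ^ 2) (by fun_prop)
  rw [← h', h, ← variance_fun_id_gaussianReal (μ := 0) (v := v),
    variance_eq_integral measurable_id'.aemeasurable, integral_id_gaussianReal]
  simp

/-! ### The state of the market -/

theorem latest_eq_some {r : ℕ → Option ℝ} {T : ℕ} {z : ℝ} (hT : r T = some z) (n t : ℕ)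
    (h1 : t < T) (h2 : T ≤ t + n) (hn : ∀ i, t < i → i < T → r i = none) :
    latest r t n = some (T, z) := by
  induction n generalizing t with
  | zero => omega
  | succ n ih =>
    rw [latest]
    rcases Nat.lt_or_ge (t + 1) T with h | h
    · rw [hn (t + 1) (by omega) h]
      exact ih (t + 1) h (by omega) fun i hi => hn i (by omega)
    · obtain rfl : T = t + 1 := by omega
      rw [hT]

theorem latest_eq_none {r : ℕ → Option ℝ} (n t : ℕ)
    (hn : ∀ i, t < i → i ≤ t + n → r i = none) : latest r t n = none := by
  induction n generalizing t with
  | zero => rfl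
  | succ n ih =>
    rw [latest, hn (t + 1) (by omega) (by omega)]
    exact ih (t + 1) fun i hi hi' => hn i (by omega) (by omega)

/-- The contribution of a prediction to the market's precision and precision-weighted mean, beyond
those of the market signal. -/
noncomputable def predictionState (q : ℝ) (T : ℕ) (z xT : ℝ) : ℝ × ℝ :=
  (q / (1 - q) * (1 / T), 1 / (1 - q) * (z / T) - xT / T)

/-- The contribution to the market's precision and precision-weighted mean of the latest prediction
at a period `> u`. -/
noncomputable def marketState (q : ℝ) (N : ℕ) (x : ℕ → ℝ) (r : ℕ → Option ℝ) (u : ℕ) : ℝ × ℝ :=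
  match latest r u (N - u) with
  | none => (0, 0)
  | some (T, z) => predictionState q T z (x T)

/-- The market's density of the outcome in the state `S` at period `t`, with market signal `xt`. -/
noncomputable def stateDensity (t : ℕ) (S : ℝ × ℝ) (xt : ℝ) : ℝ → ℝ :=
  gaussianPDFReal ((xt / t + S.2) / (1 / t + S.1)) (1 / (1 / t + S.1)).toNNReal

theorem marketState_of_some {q : ℝ} {N : ℕ} {x : ℕ → ℝ} {r : ℕ → Option ℝ} {u : ℕ} (hu : u < N)
    {z : ℝ} (h : r (u + 1) = some z) :
    marketState q N x r u = predictionState q (u + 1) z (x (u + 1)) := by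
  obtain ⟨n, rfl⟩ : ∃ n, N = u + (n + 1) := ⟨N - u - 1, by omega⟩
  simp only [marketState, Nat.add_sub_cancel_left, latest, h]

theorem marketState_of_none {q : ℝ} {N : ℕ} {x : ℕ → ℝ} {r : ℕ → Option ℝ} {u : ℕ} (hu : u < N)
    (h : r (u + 1) = none) : marketState q N x r u = marketState q N x r (u + 1) := by
  obtain ⟨n, rfl⟩ : ∃ n, N = u + (n + 1) := ⟨N - u - 1, by omega⟩
  simp only [marketState, Nat.add_sub_cancel_left, latest, h,
    show u + (n + 1) - (u + 1) = n by omega]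

theorem marketState_congr {q : ℝ} {N : ℕ} {x : ℕ → ℝ} {r r' : ℕ → Option ℝ} {u : ℕ} (hu : u ≤ N)
    (h : ∀ i ∈ Finset.Ioc u N, r i = r' i) : marketState q N x r u = marketState q N x r' u := by
  rw [marketState, marketState, latest_congr _ _ (by rwa [Nat.add_sub_cancel' hu])]

theorem marketState_fst_mem {q : ℝ} (hq0 : 0 ≤ q) (hq1 : q < 1) (N : ℕ) (x : ℕ → ℝ)
    (r : ℕ → Option ℝ) (u : ℕ) :
    (marketState q N x r u).1 ∈ Set.Icc 0 (q / (1 - q)) := by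
  have h : 0 ≤ q / (1 - q) := div_nonneg hq0 (by linarith)
  rw [marketState]
  cases hl : latest r u (N - u) with
  | none => exact ⟨le_rfl, h⟩
  | some p =>
    obtain ⟨T, z⟩ := p
    have hT := latest_mem _ _ hl
    have hT1 : (1 : ℝ) ≤ T := by
      simp only [Finset.mem_Ioc] at hT
      exact_mod_cast (by omega : 1 ≤ T)
    refine ⟨mul_nonneg h (by positivity), mul_le_of_le_one_right h ?_⟩
    rw [div_le_one (by linarith)]
    exact hT1

theorem faceValueBefore_eq {q : ℝ} {N t : ℕ} (ht : 1 ≤ t) (x : ℕ → ℝ) (r : ℕ → Option ℝ) :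
    faceValueBefore q N t x r = stateDensity t (marketState q N x r t) (x t) := by
  have ht' : (t : ℝ) ≠ 0 := by positivity
  rw [faceValueBefore, marketState]
  cases latest r t (N - t) with
  | none =>
    simp only [stateDensity, add_zero]
    rw [div_div_eq_mul_div, div_mul_cancel₀ _ ht', div_one, one_div_one_div, Real.toNNReal_natCast]
  | some p =>
    simp only [stateDensity, predictionState, marketMean, marketVar]
    congr 2
    ring

/-- The formula for the market after a prediction at `T`, evaluated at `t = T`, returns the
announced distribution. Hence one notion of state covers the densities both before and after a
prediction. -/
theorem stateDensity_predictionState {q : ℝ} (hq1 : q < 1) {t : ℕ} (ht : 1 ≤ t) (z xt : ℝ) :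
    stateDensity t (predictionState q t z xt) xt =
      gaussianPDFReal z (expertVar q t).toNNReal := by
  have ht' : (t : ℝ) ≠ 0 := by positivity
  have hq : 1 - q ≠ 0 := by linarith
  have e : 1 / (t : ℝ) + q / (1 - q) * (1 / t) = 1 / ((1 - q) * t) := by field_simp; ring
  simp only [stateDensity, predictionState, e, expertVar]
  congr 2
  · field_simp; ring
  · field_simp

theorem stateDensity_pos {t : ℕ} (ht : 1 ≤ t) {S : ℝ × ℝ} (hS : 0 ≤ S.1) (xt y : ℝ) :
    0 < stateDensity t S xt y :=
  gaussianPDFReal_pos _ _ _ (by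
    rw [Ne, Real.toNNReal_eq_zero, not_le]
    positivity)

/-! ### Rewards as log likelihoods of the next public signal -/

/-- The logarithm of the market's density. -/
noncomputable def logScore (t : ℕ) (S : ℝ × ℝ) (xt y : ℝ) : ℝ := Real.log (stateDensity t S xt y)

/-- The state indexed by `n` takes account of the action at `n + 1`, the one indexed by `n + 1` does
not. Silence leaves the state unchanged, so its zero reward needs no separate treatment. -/
theorem reward_faceValue {q : ℝ} (hq0 : 0 ≤ q) (hq1 : q < 1) {N n : ℕ} (hn : n < N)
    (r : ℕ → Option ℝ) (ω : World) :
    reward (faceValue q N) r (n + 1) ω =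
      logScore (n + 1) (marketState q N (fun i => marketSignal i ω) r n) (marketSignal (n + 1) ω)
        (outcome ω) -
      logScore (n + 1) (marketState q N (fun i => marketSignal i ω) r (n + 1))
        (marketSignal (n + 1) ω) (outcome ω) := by
  rw [reward]
  cases h : r (n + 1) with
  | none => rw [marketState_of_none hn h]; simp
  | some z =>
    rw [marketState_of_some hn h, logScore, logScore, ← Real.log_div]
    · simp only [faceValue, Option.isSome_some, if_true, h]
      rw [faceValueBefore_eq (by omega), stateDensity_predictionState hq1 (by omega)]
    · rw [stateDensity_predictionState hq1 (by omega)]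
      refine (gaussianPDFReal_pos _ _ _ ?_).ne'
      rw [Ne, Real.toNNReal_eq_zero, not_le, expertVar]
      exact mul_pos (by linarith) (by positivity)
    · exact (stateDensity_pos (by omega) (marketState_fst_mem hq0 hq1 _ _ _ _).1 _ _).ne'

theorem sum_Icc_one_eq_sum_range {M : Type*} [AddCommMonoid M] (f : ℕ → M) (s : ℕ) :
    ∑ t ∈ Finset.Icc 1 s, f t = ∑ n ∈ Finset.range s, f (n + 1) := by
  induction s with
  | zero => rfl
  | succ s ih => rw [Finset.sum_Icc_succ_top (by omega), ih, Finset.sum_range_succ]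

/-- The variance of the next market signal at period `t`, when the contribution of the predictions
to the precision of the market is `κ`. -/
noncomputable def nextVar (t : ℕ) (κ : ℝ) : ℝ := (1 + (t - 1) * κ) / (1 + t * κ)

/-- The mean of the next market signal at period `t` in the state `S`, with market signal `xt`. -/
noncomputable def nextMean (t : ℕ) (S : ℝ × ℝ) (xt : ℝ) : ℝ :=
  nextVar t S.1 * xt + S.2 / (1 + t * S.1)

/-- The logarithm, up to a constant, of the density of the next market signal `xt'` at period `t`
in the state `S`, with market signal `xt`. -/
noncomputable def nextScore (t : ℕ) (S : ℝ × ℝ) (xt xt' : ℝ) : ℝ :=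
  -(1 / 2 * Real.log (nextVar t S.1)) - (xt' - nextMean t S xt) ^ 2 / (2 * nextVar t S.1)

theorem log_gaussianPDFReal (m : ℝ) {v : ℝ} (hv : 0 < v) (y : ℝ) :
    Real.log (gaussianPDFReal m v.toNNReal y) =
      -(1 / 2 * Real.log (2 * Real.pi)) - 1 / 2 * Real.log v - (y - m) ^ 2 / (2 * v) := by
  have hp : 0 < 2 * Real.pi := by positivity
  rw [gaussianPDFReal, Real.coe_toNNReal _ hv.le, Real.log_mul (by positivity) (by positivity),
    Real.log_inv, Real.log_sqrt (by positivity), Real.log_mul hp.ne' hv.ne', Real.log_exp]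
  ring

theorem logScore_eq {t : ℕ} (ht : 1 ≤ t) {S : ℝ × ℝ} (hS : 0 ≤ S.1) (xt y : ℝ) :
    logScore t S xt y = -(1 / 2 * Real.log (2 * Real.pi)) - 1 / 2 * Real.log (1 / (1 / t + S.1)) -
      (y - (xt / t + S.2) / (1 / t + S.1)) ^ 2 / (2 * (1 / (1 / t + S.1))) :=
  log_gaussianPDFReal _ (by positivity) y

/-- At the last period the next public signal is the outcome itself. This is the end term of the
summation by parts. -/
theorem logScore_one {S : ℝ × ℝ} (hS : 0 ≤ S.1) (x y : ℝ) :
    logScore 1 S x y = nextScore 1 S x y - 1 / 2 * Real.log (2 * Real.pi) := by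
  have h : 1 + S.1 ≠ 0 := by positivity
  rw [logScore_eq le_rfl hS, nextScore, nextMean, nextVar]
  simp only [Nat.cast_one, sub_self, zero_mul, add_zero, one_mul, div_one]
  rw [show 1 / (1 + S.1) * x + S.2 / (1 + S.1) = (x + S.2) / (1 + S.1) by field_simp]
  ring

/-- Bayes' rule in logarithms: prior density of `y` times density of `x'` given `x` and `y` equals
predictive density of `x'` given `x` times posterior density of `y`. Given `x` and `y`, the signal
`x'` is a point of a Gaussian bridge, with mean `(n * x + y) / (n + 1)` and variance `n / (n + 1)`,
whatever the state. -/
theorem logScore_sub_logScore {n : ℕ} (hn : 1 ≤ n) {S : ℝ × ℝ} (hS : 0 ≤ S.1) (x x' y : ℝ) :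
    logScore (n + 1) S x y - logScore n S x' y = nextScore (n + 1) S x x' +
      (1 / 2 * Real.log (n / (n + 1)) +
        (x' - (n * x + y) / (n + 1)) ^ 2 / (2 * (n / (n + 1)))) := by
  obtain ⟨κ, η⟩ := S
  have hn' : (0 : ℝ) < n := by exact_mod_cast hn
  have hκ : 0 ≤ κ := hS
  rw [logScore_eq (by omega) hS, logScore_eq hn hS, nextScore, nextMean, nextVar]
  have ha : 0 < 1 + n * κ := by positivity
  have ha' : 0 < 1 + (n + 1) * κ := by positivity
  push_cast
  simp only [add_sub_cancel_right]
  have e1 : 1 / (1 / ((n : ℝ) + 1) + κ) = (n + 1) / (1 + (n + 1) * κ) := by field_simp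
  have e2 : 1 / (1 / (n : ℝ) + κ) = n / (1 + n * κ) := by field_simp
  rw [e1, e2, Real.log_div (by positivity) ha'.ne', Real.log_div hn'.ne' ha.ne',
    Real.log_div ha.ne' ha'.ne', Real.log_div hn'.ne' (by positivity)]
  have e3 : (y - (x / ((n : ℝ) + 1) + η) / (1 / ((n : ℝ) + 1) + κ)) ^ 2 /
        (2 * ((n + 1) / (1 + (n + 1) * κ))) -
      (y - (x' / n + η) / (1 / n + κ)) ^ 2 / (2 * (n / (1 + n * κ))) =
      (x' - ((1 + n * κ) / (1 + (n + 1) * κ) * x + η / (1 + (n + 1) * κ))) ^ 2 /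
        (2 * ((1 + n * κ) / (1 + (n + 1) * κ))) -
      (x' - (n * x + y) / (n + 1)) ^ 2 / (2 * (n / (n + 1))) := by
    have e4 : (x / ((n : ℝ) + 1) + η) / (1 / ((n : ℝ) + 1) + κ) =
      (x + (n + 1) * η) / (1 + (n + 1) * κ) := by field_simp
    have e5 : (x' / n + η) / (1 / n + κ) = (x' + n * η) / (1 + n * κ) := by field_simp
    rw [e4, e5]
    field_simp
    ring
  linear_combination -e3

/-- Summation by parts turns rewards at predictions into forecast scores at every period, and the
state-free bridge terms cancel between the policies. The effect of one action on later reference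
densities is thereby accounted for. -/
theorem rewardFrom_sub_rewardFrom {q : ℝ} (hq0 : 0 ≤ q) (hq1 : q < 1) {N : ℕ} {K : Finset ℕ}
    (π π' : Policy N K) {s : ℕ} (hs : s ≤ N) (r : ℕ → Option ℝ) (ω : World) :
    rewardFrom (faceValue q N) π s r ω - rewardFrom (faceValue q N) π' s r ω =
      ∑ n ∈ Finset.range s,
        (nextScore (n + 1) (marketState q N (fun i => marketSignal i ω) (record π s r ω) n)
            (marketSignal (n + 1) ω) (marketSignal n ω) -
          nextScore (n + 1) (marketState q N (fun i => marketSignal i ω) (record π' s r ω) n)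
            (marketSignal (n + 1) ω) (marketSignal n ω)) := by
  set X : ℕ → ℝ := fun i => marketSignal i ω with hX
  let G : ℕ → ℕ → ℝ := fun t u =>
    logScore t (marketState q N X (record π s r ω) u) (X t) (outcome ω) -
      logScore t (marketState q N X (record π' s r ω) u) (X t) (outcome ω)
  -- The boundary terms vanish: at `s` both policies inherit the same past `r`, and at `0`, where no
  -- market density is scored, the value is set to zero.
  let H : ℕ → ℝ := fun u => if u = 0 then 0 else G u u
  have hH : H s = 0 := by
    by_cases h : s = 0
    · simp [H, h]
    · have e : marketState q N X (record π s r ω) s = marketState q N X (record π' s r ω) s :=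
        marketState_congr hs fun i hi => by
          simp [record, (Finset.mem_Ioc.1 hi).1.not_ge]
      simp [H, G, e]
  have hpos (ρ : Policy N K) (u : ℕ) : 0 ≤ (marketState q N X (record ρ s r ω) u).1 :=
    (marketState_fst_mem hq0 hq1 _ _ _ _).1
  calc _ = ∑ n ∈ Finset.range s, (G (n + 1) n - H (n + 1)) := by
        rw [rewardFrom, rewardFrom, sum_Icc_one_eq_sum_range, sum_Icc_one_eq_sum_range,
          ← Finset.sum_sub_distrib]
        refine Finset.sum_congr rfl fun n hn => ?_
        have hn' : n < N := (Finset.mem_range.1 hn).trans_le hs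
        rw [reward_faceValue hq0 hq1 hn', reward_faceValue hq0 hq1 hn']
        simp only [G, H, Nat.succ_ne_zero, if_false, X]
        ring
    _ = ∑ n ∈ Finset.range s, (G (n + 1) n - H n) := by
        rw [← sub_eq_zero, ← Finset.sum_sub_distrib]
        have h := Finset.sum_range_sub H s
        rw [hH, show H 0 = 0 from if_pos rfl, sub_zero] at h
        rw [← neg_eq_zero, ← h, ← Finset.sum_neg_distrib]
        exact Finset.sum_congr rfl fun n _ => by ring
    _ = _ := by
        refine Finset.sum_congr rfl fun n _ => ?_
        rcases Nat.eq_zero_or_pos n with rfl | hn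
        · have e0 : outcome ω = X 0 := by simp [outcome, X, marketSignal]
          simp only [H, G, if_true, sub_zero, zero_add]
          rw [logScore_one (hpos _ _), logScore_one (hpos _ _), e0]
          ring
        · have h1 := logScore_sub_logScore hn (hpos π n) (X (n + 1)) (X n) (outcome ω)
          have h2 := logScore_sub_logScore hn (hpos π' n) (X (n + 1)) (X n) (outcome ω)
          simp only [H, G, hn.ne', if_false]
          linear_combination h1 - h2

/-! ### The gain from being truthful, one period at a time -/

theorem abs_log_le_of_mem_Icc {a b x : ℝ} (ha : 0 < a) (hx : x ∈ Set.Icc a b) :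
    |Real.log x| ≤ |Real.log a| + |Real.log b| := by
  have h1 := Real.log_le_log ha hx.1
  have h2 := Real.log_le_log (ha.trans_le hx.1) hx.2
  rw [abs_le]
  constructor
  · linarith [neg_abs_le (Real.log a), abs_nonneg (Real.log b)]
  · linarith [le_abs_self (Real.log b), abs_nonneg (Real.log a)]

theorem integrable_bdd_mul {Ω : Type*} {mΩ : MeasurableSpace Ω} {P : Measure Ω}
    {f g : Ω → ℝ} (hg : Integrable g P) (hf : Measurable f) (C : ℝ)
    (hC : ∀ ω, |f ω| ≤ C) : Integrable (fun ω => f ω * g ω) P :=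
  hg.bdd_mul hf.aestronglyMeasurable (Filter.Eventually.of_forall hC)

theorem memLp_bdd_mul {Ω : Type*} {mΩ : MeasurableSpace Ω} {P : Measure Ω}
    {f g : Ω → ℝ} (hg : MemLp g 2 P) (hf : Measurable f) (C : ℝ)
    (hC : ∀ ω, |f ω| ≤ C) : MemLp (fun ω => f ω * g ω) 2 P :=
  hg.of_le_mul (c := C) (hf.aestronglyMeasurable.mul hg.1) (Filter.Eventually.of_forall fun ω => by
    rw [norm_mul]
    exact mul_le_mul_of_nonneg_right (hC ω) (norm_nonneg _))

section

variable {Ω : Type*} {m mΩ : MeasurableSpace Ω} {P : Measure Ω} [IsProbabilityMeasure P]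

theorem integrable_log_of_mem_Icc {w : Ω → ℝ} (hw : Measurable w) {a b : ℝ} (ha : 0 < a)
    (h : ∀ ω, w ω ∈ Set.Icc a b) : Integrable (fun ω => Real.log (w ω)) P :=
  Integrable.of_bound hw.log.aestronglyMeasurable (|Real.log a| + |Real.log b|)
    (Filter.Eventually.of_forall fun ω => abs_log_le_of_mem_Icc ha (h ω))

/-- The expected log likelihood ratio of the true conditional density `N(0, v)` of `D` and another
Gaussian density, given information that is independent of `D`, is nonnegative. -/
theorem condExp_logLikelihoodRatio_nonneg (hm : m ≤ mΩ) {D : Ω → ℝ} (hD : Measurable D)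
    (hind : Indep m (MeasurableSpace.comap D inferInstance) P) {v : ℝ} (hv : 0 < v)
    (hlaw : P.map D = gaussianReal 0 v.toNNReal) {w δ : Ω → ℝ} (hw : Measurable[m] w)
    (hδ : Measurable[m] δ) {a b : ℝ} (ha : 0 < a) (hab : ∀ ω, w ω ∈ Set.Icc a b)
    (hint : Integrable (fun ω => -(1 / 2 * Real.log (w ω)) - (D ω + δ ω) ^ 2 / (2 * w ω)) P) :
    0 ≤ᵐ[P] P[fun ω => (-(1 / 2 * Real.log v) - D ω ^ 2 / (2 * v)) -
      (-(1 / 2 * Real.log (w ω)) - (D ω + δ ω) ^ 2 / (2 * w ω)) | m] := by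
  have hw' : Measurable w := hw.mono hm le_rfl
  have hδ' : Measurable δ := hδ.mono hm le_rfl
  have hwpos (ω : Ω) : 0 < w ω := ha.trans_le (hab ω).1
  have hD2 : MemLp D 2 P := memLp_two_of_map_gaussianReal hD hlaw
  have hDsq : Integrable (fun ω => D ω ^ 2) P := hD2.integrable_sq
  have hlog : Integrable (fun ω => Real.log (w ω)) P := integrable_log_of_mem_Icc hw' ha hab
  have hinv (ω : Ω) : |(w ω)⁻¹| ≤ a⁻¹ := by
    rw [abs_of_pos (inv_pos.2 (hwpos ω))]
    exact inv_anti₀ ha (hab ω).1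
  -- The forecast error of the rival is recovered from its score by multiplying with the bounded
  -- variance `w`. Thus integrability of the score already forces `δ` to be square integrable, with
  -- no moment assumption on announcements.
  have hsum : MemLp (fun ω => D ω + δ ω) 2 P := by
    refine (memLp_two_iff_integrable_sq (hD.add hδ').aestronglyMeasurable).2 ?_
    have h := integrable_bdd_mul ((hint.add (hlog.const_mul (1 / 2))).neg) (hw'.const_mul 2) (2 * b)
      fun ω => by
        rw [abs_of_pos (mul_pos two_pos (hwpos ω))]
        linarith [(hab ω).2]
    refine h.congr (Filter.Eventually.of_forall fun ω => ?_)
    have := (hwpos ω).ne'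
    simp only [Pi.neg_apply, Pi.add_apply]
    field_simp
    ring
  have hδ2 : MemLp δ 2 P := by
    refine (hsum.sub hD2).ae_eq (Filter.Eventually.of_forall fun ω => ?_)
    simp
  -- These are the coefficients of the two parts of the log likelihood ratio that have conditional
  -- mean zero, `D ^ 2 - v` and `D`. The rest is a Kullback–Leibler divergence.
  let h1 : Ω → ℝ := fun ω => -(1 / 2) * (v⁻¹ - (w ω)⁻¹)
  let h2 : Ω → ℝ := fun ω => (w ω)⁻¹ * δ ω
  have hh1 : Measurable[m] h1 := (measurable_const.sub hw.inv).const_mul _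
  have hh2 : Measurable[m] h2 := hw.inv.mul hδ
  have hg1 : Integrable (fun ω => D ω ^ 2 - v) P := hDsq.sub (integrable_const v)
  have hi1 : Integrable (fun ω => h1 ω * (D ω ^ 2 - v)) P := by
    refine integrable_bdd_mul hg1 (hh1.mono hm le_rfl) (v⁻¹ + a⁻¹) fun ω => ?_
    have h3 := abs_sub v⁻¹ (w ω)⁻¹
    rw [abs_of_pos (inv_pos.2 hv)] at h3
    simp only [h1, abs_mul]
    rw [abs_neg, abs_of_pos (by norm_num : (0 : ℝ) < 1 / 2)]
    linarith [hinv ω, abs_nonneg (v⁻¹ - (w ω)⁻¹)]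
  have hi2 : Integrable (fun ω => h2 ω * D ω) P :=
    (memLp_bdd_mul hδ2 hw'.inv _ hinv).integrable_mul hD2
  have hz1 : ∫ ω, (D ω ^ 2 - v) ∂P = 0 := by
    rw [integral_sub hDsq (integrable_const v), integral_sq_eq_of_map_gaussianReal hD hlaw,
      Real.coe_toNNReal _ hv.le]
    simp
  have c1 := condExp_mul_comp_eq_zero hm (g := fun d => d ^ 2 - v) hD hind hh1 (by fun_prop)
    hg1 hz1 hi1
  have c2 := condExp_mul_comp_eq_zero hm (g := fun d => d) hD hind hh2 (by fun_prop)
    (hD2.integrable one_le_two) (integral_eq_zero_of_map_gaussianReal hD hlaw) hi2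
  have hmono := condExp_mono (m := m) (hi1.add hi2)
    (((integrable_const (-(1 / 2 * Real.log v))).sub (hDsq.div_const (2 * v))).sub hint)
    -- After removing the centred terms, `δ ^ 2 / (2 * w)` remains along with a term in `w / v` that
    -- is nonnegative by `1 - 1 / r ≤ log r` at `r = w / v`.
    (Filter.Eventually.of_forall fun ω => by
      have hwω := hwpos ω
      have hl := Real.one_sub_inv_le_log_of_pos (div_pos hwω hv)
      rw [Real.log_div hwω.ne' hv.ne', inv_div] at hl
      simp only [Pi.add_apply, Pi.sub_apply, h1, h2]
      have e : (-(1 / 2 * Real.log v) - D ω ^ 2 / (2 * v)) -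
          (-(1 / 2 * Real.log (w ω)) - (D ω + δ ω) ^ 2 / (2 * w ω)) -
          (-(1 / 2) * (v⁻¹ - (w ω)⁻¹) * (D ω ^ 2 - v) + (w ω)⁻¹ * δ ω * D ω) =
          1 / 2 * (Real.log (w ω) - Real.log v - (1 - v / w ω)) + δ ω ^ 2 / (2 * w ω) := by
        field_simp
        ring
      have : 0 ≤ δ ω ^ 2 / (2 * w ω) := by positivity
      linarith)
  filter_upwards [c1, c2, condExp_add hi1 hi2 m, hmono] with ω h1 h2 h3 h4
  refine le_trans (le_of_eq ?_) h4
  rw [h3, Pi.add_apply, h1, h2]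
  simp

end

/-- Uniform bounds away from zero and infinity, valid for every rival state, are what the
integrability arguments rest on. -/
theorem nextVar_mem {t : ℕ} (ht : 1 ≤ t) {κ κm : ℝ} (hκ : κ ∈ Set.Icc 0 κm) :
    nextVar t κ ∈ Set.Icc (1 / (1 + t * κm)) 1 := by
  have ht' : (1 : ℝ) ≤ t := by exact_mod_cast ht
  have h0 : 0 ≤ κ := hκ.1
  have hm : 0 ≤ κm := h0.trans hκ.2
  have hp : 0 < 1 + t * κ := by positivity
  constructor
  · refine div_le_div₀ (by nlinarith) (by nlinarith) hp ?_
    have := mul_le_mul_of_nonneg_left hκ.2 (by positivity : (0 : ℝ) ≤ t)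
    linarith
  · rw [nextVar, div_le_one hp]
    nlinarith

/-- In a state left by a prediction, the forecast computed by the market has the coefficients of the
best linear prediction; after a truthful one its error is therefore the independent `predError`. -/
theorem predictionState_nextMean {q : ℝ} (hq0 : 0 ≤ q) (hq1 : q < 1) {k n : ℕ} (hk : 1 ≤ k)
    (y xk xt : ℝ) :
    nextMean (n + 1) (predictionState q k y xk) xt =
      (precDenom q k n * xt + (y - (1 - q) * xk)) / precDenom q k (n + 1) ∧
    nextVar (n + 1) (predictionState q k y xk).1 = precDenom q k n / precDenom q k (n + 1) := by
  have hk' : (0 : ℝ) < k := by exact_mod_cast hk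
  have hq : 0 < 1 - q := by linarith
  have he := (precDenom_pos hq0 hq1 hk (n + 1)).ne'
  have e (a : ℝ) : 1 + a * (q / (1 - q) * (1 / k)) = ((1 - q) * k + q * a) / ((1 - q) * k) := by
    field_simp
  have hv : nextVar (n + 1) (predictionState q k y xk).1 =
      precDenom q k n / precDenom q k (n + 1) := by
    rw [nextVar, predictionState]
    dsimp only
    rw [e, e, div_div_div_cancel_right₀ (by positivity)]
    simp [precDenom]
  refine ⟨?_, hv⟩
  rw [nextMean, hv, predictionState]
  dsimp only
  rw [e]
  unfold precDenom at he ⊢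
  field_simp

theorem sub_nextMean_eq_predError {q : ℝ} (hq0 : 0 ≤ q) (hq1 : q < 1) {k n : ℕ} (hk : 1 ≤ k)
    (ω : World) :
    marketSignal n ω - nextMean (n + 1) (predictionState q k (expertSignal k ω) (marketSignal k ω))
      (marketSignal (n + 1) ω) = predError q k (n + 1) n ω := by
  rw [(predictionState_nextMean hq0 hq1 hk _ _ _).1, predError]
  push_cast
  ring

@[fun_prop]
theorem measurable_nextMean {Ω : Type*} {_ : MeasurableSpace Ω} (t : ℕ) {S : Ω → ℝ × ℝ} {x : Ω → ℝ}
    (hS : Measurable S) (hx : Measurable x) : Measurable fun ω => nextMean t (S ω) (x ω) := by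
  unfold nextMean nextVar; fun_prop

@[fun_prop]
theorem measurable_nextVar {Ω : Type*} {_ : MeasurableSpace Ω} (t : ℕ) {κ : Ω → ℝ}
    (hS : Measurable κ) : Measurable fun ω => nextVar t (κ ω) := by
  unfold nextVar; fun_prop

/-- The gain at period `t = n + 1` from the truthful market state rather than the state `S`. -/
noncomputable def truthGain (q : ℝ) (k n : ℕ) (S : World → ℝ × ℝ) (ω : World) : ℝ :=
  nextScore (n + 1) (predictionState q k (expertSignal k ω) (marketSignal k ω))
      (marketSignal (n + 1) ω) (marketSignal n ω) -
    nextScore (n + 1) (S ω) (marketSignal (n + 1) ω) (marketSignal n ω)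

theorem truthGain_eq {q : ℝ} (hq0 : 0 ≤ q) (hq1 : q < 1) {k n : ℕ} (hk : 1 ≤ k)
    (S : World → ℝ × ℝ) (ω : World) :
    truthGain q k n S ω =
      (-(1 / 2 * Real.log (precDenom q k n / precDenom q k (n + 1))) -
        predError q k (n + 1) n ω ^ 2 / (2 * (precDenom q k n / precDenom q k (n + 1)))) -
      nextScore (n + 1) (S ω) (marketSignal (n + 1) ω) (marketSignal n ω) := by
  rw [truthGain, nextScore, sub_nextMean_eq_predError hq0 hq1 hk,
    (predictionState_nextMean hq0 hq1 hk (expertSignal k ω) (marketSignal k ω) 0).2]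

theorem memLp_predError {q : ℝ} (hq0 : 0 ≤ q) (hq1 : q < 1) {N k t u : ℕ} (x : ℝ)
    (hk : 1 ≤ k) (hut : u ≤ t) (htk : t ≤ k) (hkN : k ≤ N) :
    MemLp (predError q k t u) 2 (worldLaw q N x) :=
  memLp_two_of_map_gaussianReal (by fun_prop) (map_predError hq0 hq1 x hk hut htk hkN)

/-- The rival's score is bounded above because its forecast variance is bounded below; its quadratic
error term only lowers it. The truthful score is integrable. -/
theorem exists_integrable_le_truthGain {q : ℝ} (hq0 : 0 ≤ q) (hq1 : q < 1) {N k n : ℕ} (x : ℝ)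
    (hnk : n + 1 ≤ k) (hkN : k ≤ N) {S : World → ℝ × ℝ} {κm : ℝ}
    (hS : ∀ ω, (S ω).1 ∈ Set.Icc 0 κm) :
    ∃ L : World → ℝ, Integrable L (worldLaw q N x) ∧ ∀ ω, L ω ≤ truthGain q k n S ω := by
  have hk : 1 ≤ k := by omega
  refine ⟨fun ω => (-(1 / 2 * Real.log (precDenom q k n / precDenom q k (n + 1))) -
        predError q k (n + 1) n ω ^ 2 / (2 * (precDenom q k n / precDenom q k (n + 1)))) +
      1 / 2 * Real.log (1 / (1 + (n + 1 : ℕ) * κm)), ?_, fun ω => ?_⟩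
  · exact ((integrable_const _).sub ((memLp_predError hq0 hq1 x hk (Nat.le_succ n) hnk
      hkN).integrable_sq.div_const _)).add (integrable_const _)
  · rw [truthGain_eq hq0 hq1 hk, sub_eq_add_neg _ (nextScore _ _ _ _)]
    refine add_le_add le_rfl ?_
    have hw := nextVar_mem (t := n + 1) (by omega) (hS ω)
    have h0 : 0 < 1 / (1 + ((n + 1 : ℕ) : ℝ) * κm) := by
      have : 0 ≤ κm := (hS ω).1.trans (hS ω).2
      positivity
    have hlog := Real.log_le_log h0 hw.1
    have : 0 < nextVar (n + 1) (S ω).1 := h0.trans_le hw.1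
    have : 0 ≤ (marketSignal n ω - nextMean (n + 1) (S ω) (marketSignal (n + 1) ω)) ^ 2 /
      (2 * nextVar (n + 1) (S ω).1) := by positivity
    rw [nextScore]
    linarith

/-- Given the joint information, the truthful state forecasts the next signal with its true law. The
rival state is known at `k`, so it is merely another Gaussian forecast based on the same
information, and Gibbs' inequality applies. -/
theorem condExp_truthGain_nonneg {q : ℝ} (hq0 : 0 ≤ q) (hq1 : q < 1) {N k n : ℕ} (x : ℝ)
    (hnk : n + 1 ≤ k) (hkN : k ≤ N) {S : World → ℝ × ℝ} {κm : ℝ}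
    (hS : ∀ ω, (S ω).1 ∈ Set.Icc 0 κm) (hSm : Measurable[expertInfo N k] S)
    (hint : Integrable (truthGain q k n S) (worldLaw q N x)) :
    0 ≤ᵐ[worldLaw q N x] (worldLaw q N x)[truthGain q k n S | jointInfo N k (n + 1)] := by
  have hk : 1 ≤ k := by omega
  have hv : 0 < precDenom q k n / precDenom q k (n + 1) :=
    div_pos (precDenom_pos hq0 hq1 hk _) (precDenom_pos hq0 hq1 hk _)
  have hle := jointInfo_le N k (n + 1)
  have hSj : Measurable[jointInfo N k (n + 1)] S := hSm.mono (expertInfo_le_jointInfo _ _ _) le_rfl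
  have hX : Measurable[jointInfo N k (n + 1)] (marketSignal (n + 1)) :=
    measurable_marketSignal_jointInfo le_rfl (by omega)
  have hstar : Measurable[jointInfo N k (n + 1)] fun ω =>
      predictionState q k (expertSignal k ω) (marketSignal k ω) := by
    have h1 : Measurable[jointInfo N k (n + 1)] (expertSignal k) :=
      (measurable_expertSignal N k hkN).mono (expertInfo_le_jointInfo _ _ _) le_rfl
    have h2 : Measurable[jointInfo N k (n + 1)] (marketSignal k) :=
      measurable_marketSignal_jointInfo hnk hkN
    exact measurable_const.prodMk (((h1.div_const _).const_mul _).sub (h2.div_const _))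
  have hlaw := map_predError hq0 hq1 x hk (Nat.le_succ n) hnk hkN
  rw [show (((n + 1 : ℕ) : ℝ) - n) * precDenom q k n / precDenom q k (n + 1) =
    precDenom q k n / precDenom q k (n + 1) by push_cast; ring] at hlaw
  have h0 : 0 < 1 / (1 + ((n + 1 : ℕ) : ℝ) * κm) := by
    have : 0 ≤ κm := (hS (0, 0, 0)).1.trans (hS (0, 0, 0)).2
    positivity
  let δ : World → ℝ := fun ω =>
    nextMean (n + 1) (predictionState q k (expertSignal k ω) (marketSignal k ω))
      (marketSignal (n + 1) ω) - nextMean (n + 1) (S ω) (marketSignal (n + 1) ω)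
  have hδ : Measurable[jointInfo N k (n + 1)] δ :=
    (measurable_nextMean _ hstar hX).sub (measurable_nextMean _ hSj hX)
  have e (ω : World) : nextScore (n + 1) (S ω) (marketSignal (n + 1) ω) (marketSignal n ω) =
      -(1 / 2 * Real.log (nextVar (n + 1) (S ω).1)) -
        (predError q k (n + 1) n ω + δ ω) ^ 2 / (2 * nextVar (n + 1) (S ω).1) := by
    rw [nextScore, ← sub_nextMean_eq_predError hq0 hq1 hk]
    simp only [δ]
    ring_nf
  have e' : truthGain q k n S = fun ω =>
      (-(1 / 2 * Real.log (precDenom q k n / precDenom q k (n + 1))) -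
        predError q k (n + 1) n ω ^ 2 / (2 * (precDenom q k n / precDenom q k (n + 1)))) -
      (-(1 / 2 * Real.log (nextVar (n + 1) (S ω).1)) -
        (predError q k (n + 1) n ω + δ ω) ^ 2 / (2 * nextVar (n + 1) (S ω).1)) := by
    funext ω
    rw [truthGain_eq hq0 hq1 hk, e]
  have hD2 := (memLp_predError hq0 hq1 x hk (Nat.le_succ n) hnk hkN).integrable_sq
  rw [e'] at hint ⊢
  refine condExp_logLikelihoodRatio_nonneg hle (measurable_predError _ _ _ _)
    (indep_predError hq0 hq1 x hk (Nat.le_succ n) hnk hkN) hv hlaw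
    (w := fun ω => nextVar (n + 1) (S ω).1) (δ := δ) (measurable_nextVar _ hSj.fst)
    hδ h0 (fun ω => nextVar_mem (by omega) (hS ω)) ?_
  refine ((((integrable_const (-(1 / 2 * Real.log (precDenom q k n / precDenom q k (n + 1))))).sub
    (hD2.div_const (2 * (precDenom q k n / precDenom q k (n + 1))))).sub hint)).congr
    (Filter.Eventually.of_forall fun ω => ?_)
  simp only [Pi.sub_apply]
  ring

/-! ### The market state under a policy -/

theorem marketState_eq_ite {q : ℝ} {N : ℕ} {x : ℕ → ℝ} {r : ℕ → Option ℝ} {u : ℕ} (hu : u < N) :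
    marketState q N x r u = if (encode (r (u + 1))).1 = true then
      predictionState q (u + 1) (encode (r (u + 1))).2 (x (u + 1))
      else marketState q N x r (u + 1) := by
  cases h : r (u + 1) with
  | none => rw [marketState_of_none hu h]; simp [encode]
  | some z => rw [marketState_of_some hu h]; simp [encode]

theorem measurable_predictionState {Ω : Type*} {_ : MeasurableSpace Ω} (q : ℝ) (T : ℕ)
    {z x : Ω → ℝ} (hz : Measurable z) (hx : Measurable x) :
    Measurable fun ω => predictionState q T (z ω) (x ω) := by
  unfold predictionState; fun_prop

theorem measurable_marketState (q : ℝ) {N : ℕ} {R : World → ℕ → Option ℝ} (n : ℕ) {u : ℕ}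
    (hu : u + n = N) (hR : ∀ i, u < i → i ≤ N → Measurable[expertInfo N i] fun ω => encode (R ω i)) :
    Measurable[expertInfo N (u + 1)] fun ω =>
      marketState q N (fun i => marketSignal i ω) (R ω) u := by
  induction n generalizing u with
  | zero =>
    obtain rfl : u = N := by omega
    simp only [marketState, Nat.sub_self, latest]
    exact measurable_const
  | succ n ih =>
    have huN : u < N := by omega
    have h1 := hR (u + 1) (Nat.lt_succ_self u) huN
    have h2 := (ih (u := u + 1) (by omega) fun i hi => hR i (by omega)).mono
      (expertInfo_anti (N := N) (Nat.le_succ (u + 1))) le_rfl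
    simp only [marketState_eq_ite huN]
    exact Measurable.ite (h1.fst (measurableSet_singleton true))
      (measurable_predictionState q (u + 1) h1.snd
        (measurable_marketSignal_expertInfo le_rfl huN)) h2

theorem measurable_encode_record {N : ℕ} {K : Finset ℕ} (π : Policy N K) (s : ℕ)
    (r : ℕ → Option ℝ) (i : ℕ) :
    Measurable[expertInfo N i] fun ω => encode (record π s r ω i) := by
  by_cases h : i ≤ s
  · simpa only [record, h, if_true] using π.measurable i
  · simpa only [record, h, if_false] using measurable_const

theorem measurable_marketState_record (q : ℝ) {N : ℕ} {K : Finset ℕ} (π : Policy N K) (s : ℕ)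
    (r : ℕ → Option ℝ) {u : ℕ} (hu : u ≤ N) :
    Measurable[expertInfo N (u + 1)] fun ω =>
      marketState q N (fun i => marketSignal i ω) (record π s r ω) u :=
  measurable_marketState q (N - u) (by omega) fun i _ _ => measurable_encode_record π s r i

/-- After the actions at periods `> u`, the market state under a policy is the one under the
truthful policy, or there has been a truthful prediction, with no further one. -/
theorem marketState_truthful_cases (q : ℝ) {N : ℕ} {K : Finset ℕ} (hK : K ⊆ Finset.Icc 1 N)
    (π : Policy N K) {s : ℕ} (hs : s ≤ N) (r : ℕ → Option ℝ) (n : ℕ) {u : ℕ} (hu : u + n = s) :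
    (∀ ω, marketState q N (fun i => marketSignal i ω) (record (truthful hK) s r ω) u =
      marketState q N (fun i => marketSignal i ω) (record π s r ω) u) ∨
    ∃ k, u < k ∧ k ≤ s ∧
      (∀ ω, marketState q N (fun i => marketSignal i ω) (record (truthful hK) s r ω) u =
        predictionState q k (expertSignal k ω) (marketSignal k ω)) ∧
      Measurable[expertInfo N k] fun ω =>
        marketState q N (fun i => marketSignal i ω) (record π s r ω) u := by
  induction n generalizing u with
  | zero =>
    refine Or.inl fun ω => marketState_congr (by omega) fun i hi => ?_
    have : ¬ i ≤ s := by have := (Finset.mem_Ioc.1 hi).1; omega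
    simp [record, this]
  | succ n ih =>
    have hus : u + 1 ≤ s := by omega
    have huN : u < N := by omega
    -- If prediction is allowed, the truthful policy resets the state here, and any rival state is
    -- known at this period. Otherwise both states are carried over, so the information index `k`
    -- does not move.
    by_cases hk : u + 1 ∈ K
    · refine Or.inr ⟨u + 1, Nat.lt_succ_self u, hus, fun ω => ?_,
        measurable_marketState_record q π s r huN.le⟩
      exact marketState_of_some huN (by simp [record, hus, truthful, hk])
    · have h1 (ω : World) := marketState_of_none (q := q) (x := fun i => marketSignal i ω)
        (r := record (truthful hK) s r ω) huN (by simp [record, hus, truthful, hk])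
      have h2 (ω : World) := marketState_of_none (q := q) (x := fun i => marketSignal i ω)
        (r := record π s r ω) huN (by simp [record, hus, π.silent _ hk])
      simp only [h1, h2]
      rcases ih (u := u + 1) (by omega) with h | ⟨k, hk1, hk2, h⟩
      · exact Or.inl h
      · exact Or.inr ⟨k, by omega, hk2, h⟩

/-! ### Integrability of the truthful reward -/

theorem memLp_noise (q : ℝ) (N : ℕ) (w : ℕ ⊕ ℕ → ℝ) : MemLp (noise N w) 2 (stepLaw q) :=
  ((isGaussianProcess_noise q N).hasGaussianLaw_eval w).memLp_two

theorem memLp_marketSignal (q : ℝ) {N i : ℕ} (hi : i ≤ N) (x : ℝ) :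
    MemLp (marketSignal i) 2 (worldLaw q N x) := by
  refine (memLp_map_measure_iff (measurable_marketSignal i).aestronglyMeasurable
    (measurable_worldFrom N x).aemeasurable).2 ?_
  rw [show marketSignal i ∘ worldFrom N x = fun ab => x - noise N (marketWeight i) ab from
    funext fun ab => marketSignal_worldFrom hi x ab]
  exact (memLp_const x).sub (memLp_noise q N _)

theorem memLp_expertSignal (q : ℝ) {N i : ℕ} (hi : i ≤ N) (x : ℝ) :
    MemLp (expertSignal i) 2 (worldLaw q N x) := by
  refine (memLp_map_measure_iff (measurable_expertSignal' i).aestronglyMeasurable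
    (measurable_worldFrom N x).aemeasurable).2 ?_
  rw [show expertSignal i ∘ worldFrom N x = fun ab => x - noise N (expertWeight i) ab from
    funext fun ab => expertSignal_worldFrom hi x ab]
  exact (memLp_const x).sub (memLp_noise q N _)

theorem memLp_outcome (q : ℝ) (N : ℕ) (x : ℝ) : MemLp outcome 2 (worldLaw q N x) := by
  rw [show outcome = marketSignal 0 by funext ω; simp [outcome, marketSignal]]
  exact memLp_marketSignal q (Nat.zero_le N) x

theorem integrable_logScore {q : ℝ} {N t : ℕ} (ht : 1 ≤ t) (htN : t ≤ N) (x : ℝ)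
    {S : World → ℝ × ℝ} {κm : ℝ} (hSm : Measurable S) (hS : ∀ ω, (S ω).1 ∈ Set.Icc 0 κm)
    (hS2 : MemLp (fun ω => (S ω).2) 2 (worldLaw q N x)) :
    Integrable (fun ω => logScore t (S ω) (marketSignal t ω) (outcome ω)) (worldLaw q N x) := by
  have ht' : (0 : ℝ) < 1 / t := by positivity
  have hκ : 0 ≤ κm := (hS (0, 0, 0)).1.trans (hS (0, 0, 0)).2
  have hp (ω : World) : 1 / (t : ℝ) ≤ 1 / t + (S ω).1 := by linarith [(hS ω).1]
  have hp' (ω : World) : 0 < 1 / (t : ℝ) + (S ω).1 := ht'.trans_le (hp ω)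
  have hpm (ω : World) : 1 / (t : ℝ) + (S ω).1 ≤ 1 / t + κm := by linarith [(hS ω).2]
  have hpM : Measurable fun ω => 1 / (t : ℝ) + (S ω).1 := hSm.fst.const_add _
  have hlog : Integrable (fun ω => Real.log (1 / (1 / (t : ℝ) + (S ω).1))) (worldLaw q N x) :=
    integrable_log_of_mem_Icc (hpM.const_div 1) (a := 1 / (1 / t + κm)) (b := 1 / (1 / t))
      (by positivity) fun ω => ⟨one_div_le_one_div_of_le (hp' ω) (hpm ω),
        one_div_le_one_div_of_le ht' (hp ω)⟩
  have hmean : MemLp (fun ω => (1 / (t : ℝ) + (S ω).1)⁻¹ * (marketSignal t ω / t + (S ω).2)) 2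
      (worldLaw q N x) := by
    refine memLp_bdd_mul ?_ hpM.inv (1 / (t : ℝ))⁻¹ fun ω => ?_
    · refine MemLp.add ?_ hS2
      simpa only [div_eq_mul_inv] using (memLp_marketSignal q htN x).mul_const _
    · rw [abs_of_pos (inv_pos.2 (hp' ω))]
      exact inv_anti₀ ht' (hp ω)
  have hsq := ((memLp_outcome q N x).sub hmean).integrable_sq
  have hsq' := integrable_bdd_mul hsq (hpM.div_const 2) ((1 / t + κm) / 2) fun ω => by
    rw [abs_of_pos (div_pos (hp' ω) two_pos)]
    linarith [hpm ω]
  refine (((integrable_const (-(1 / 2 * Real.log (2 * Real.pi)))).sub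
    (hlog.const_mul (1 / 2))).sub hsq').congr (Filter.Eventually.of_forall fun ω => ?_)
  have h := (hp' ω).ne'
  simp only [Pi.sub_apply]
  rw [logScore_eq ht (hS ω).1]
  congr 1
  field_simp

/-- A truthful state is affine in square-integrable signals. The state inherited from `r` is too,
since the past announcements in `r` are fixed numbers. -/
theorem memLp_marketState_truthful (q : ℝ) {N : ℕ} {K : Finset ℕ} (hK : K ⊆ Finset.Icc 1 N)
    {s : ℕ} (hs : s ≤ N) (r : ℕ → Option ℝ) (x : ℝ) (n : ℕ) {u : ℕ} (hu : u + n = s) :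
    MemLp (fun ω => (marketState q N (fun i => marketSignal i ω)
      (record (truthful hK) s r ω) u).2) 2 (worldLaw q N x) := by
  induction n generalizing u with
  | zero =>
    have e (ω : World) : marketState q N (fun i => marketSignal i ω)
        (record (truthful hK) s r ω) u = marketState q N (fun i => marketSignal i ω) r u :=
      marketState_congr (by omega) fun i hi => by
        have : ¬ i ≤ s := by have := (Finset.mem_Ioc.1 hi).1; omega
        simp [record, this]
    simp only [e]
    simp only [marketState]
    cases hl : latest r u (N - u) with
    | none => exact memLp_const (0 : ℝ)
    | some p =>
      obtain ⟨T, z⟩ := p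
      have hT := Finset.mem_Ioc.1 (latest_mem _ _ hl)
      simp only [predictionState]
      refine (memLp_const _).sub ?_
      simpa only [div_eq_mul_inv] using
        (memLp_marketSignal q (show T ≤ N by omega) x).mul_const (T : ℝ)⁻¹
  | succ n ih =>
    have hus : u + 1 ≤ s := by omega
    have huN : u < N := by omega
    by_cases hk : u + 1 ∈ K
    · have h1 (ω : World) := marketState_of_some (q := q) (x := fun i => marketSignal i ω)
        (r := record (truthful hK) s r ω) huN (z := expertSignal (u + 1) ω)
        (by simp [record, hus, truthful, hk])
      simp only [h1, predictionState]
      refine MemLp.sub (MemLp.const_mul ?_ _) ?_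
      · simpa only [div_eq_mul_inv] using (memLp_expertSignal q huN x).mul_const _
      · simpa only [div_eq_mul_inv] using (memLp_marketSignal q huN x).mul_const _
    · have h1 (ω : World) := marketState_of_none (q := q) (x := fun i => marketSignal i ω)
        (r := record (truthful hK) s r ω) huN (by simp [record, hus, truthful, hk])
      simp only [h1]
      exact ih (by omega)

theorem rewardFrom_eq_sum {q : ℝ} (hq0 : 0 ≤ q) (hq1 : q < 1) {N : ℕ} {K : Finset ℕ}
    (π : Policy N K) {s : ℕ} (hs : s ≤ N) (r : ℕ → Option ℝ) (ω : World) :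
    rewardFrom (faceValue q N) π s r ω = ∑ n ∈ Finset.range s,
      (logScore (n + 1) (marketState q N (fun i => marketSignal i ω) (record π s r ω) n)
          (marketSignal (n + 1) ω) (outcome ω) -
        logScore (n + 1) (marketState q N (fun i => marketSignal i ω) (record π s r ω) (n + 1))
          (marketSignal (n + 1) ω) (outcome ω)) := by
  rw [rewardFrom, sum_Icc_one_eq_sum_range]
  exact Finset.sum_congr rfl fun n hn =>
    reward_faceValue hq0 hq1 ((Finset.mem_range.1 hn).trans_le hs) _ ω

theorem integrable_rewardFrom_truthful {q : ℝ} (hq0 : 0 ≤ q) (hq1 : q < 1) {N : ℕ} {K : Finset ℕ}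
    (hK : K ⊆ Finset.Icc 1 N) {s : ℕ} (hs : s ≤ N) (r : ℕ → Option ℝ) (x : ℝ) :
    Integrable (rewardFrom (faceValue q N) (truthful hK) s r) (worldLaw q N x) := by
  have h {t u : ℕ} (ht : 1 ≤ t) (hts : t ≤ s) (hus : u ≤ s) :=
    integrable_logScore (q := q) ht (hts.trans hs) x
      ((measurable_marketState_record q (truthful hK) s r (hus.trans hs)).mono
        (expertInfo_le N (u + 1)) le_rfl)
      (fun ω => marketState_fst_mem hq0 hq1 _ _ _ _)
      (memLp_marketState_truthful q hK hs r x (s - u) (by omega))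
  rw [show rewardFrom (faceValue q N) (truthful hK) s r = _ from
    funext fun ω => rewardFrom_eq_sum hq0 hq1 (truthful hK) hs r ω]
  refine integrable_finsetSum _ fun n hn => ?_
  have hn' : n + 1 ≤ s := Finset.mem_range.1 hn
  exact (h (Nat.succ_pos n) hn' (by omega)).sub (h (Nat.succ_pos n) hn' hn')

theorem measurable_logScore {Ω : Type*} {_ : MeasurableSpace Ω} {t : ℕ} (ht : 1 ≤ t)
    {S : Ω → ℝ × ℝ} {x y : Ω → ℝ} (hS : Measurable S) (h0 : ∀ ω, 0 ≤ (S ω).1) (hx : Measurable x)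
    (hy : Measurable y) : Measurable fun ω => logScore t (S ω) (x ω) (y ω) := by
  simp only [logScore_eq ht (h0 _)]
  fun_prop

theorem measurable_rewardFrom {q : ℝ} (hq0 : 0 ≤ q) (hq1 : q < 1) {N : ℕ} {K : Finset ℕ}
    (π : Policy N K) {s : ℕ} (hs : s ≤ N) (r : ℕ → Option ℝ) :
    Measurable (rewardFrom (faceValue q N) π s r) := by
  rw [show rewardFrom (faceValue q N) π s r = _ from
    funext fun ω => rewardFrom_eq_sum hq0 hq1 π hs r ω]
  refine Finset.measurable_fun_sum _ fun n hn => ?_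
  have hn' : n + 1 ≤ s := Finset.mem_range.1 hn
  have h {u : ℕ} (hus : u ≤ s) :=
    measurable_logScore (t := n + 1) (Nat.succ_pos n)
      ((measurable_marketState_record q π s r (hus.trans hs)).mono
        (expertInfo_le N (u + 1)) le_rfl)
      (fun ω => (marketState_fst_mem hq0 hq1 _ _ _ _).1) (measurable_marketSignal (n + 1))
      measurable_outcome
  exact (h (by omega)).sub (h hn')

/-! ### Optimality of truthful predictions -/

/-- Integrability and conditional expectations of a finite sum of gains, each bounded below by an
integrable function, that is bounded above in mean. -/
theorem integrable_of_sum_le {Ω : Type*} {mΩ : MeasurableSpace Ω} {P : Measure Ω} {s : Finset ℕ}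
    {f L : ℕ → Ω → ℝ} (hf : ∀ n ∈ s, Measurable (f n)) (hL : ∀ n ∈ s, Integrable (L n) P)
    (hLf : ∀ n ∈ s, ∀ ω, L n ω ≤ f n ω) (hsum : Integrable (fun ω => ∑ n ∈ s, f n ω) P) :
    ∀ n ∈ s, Integrable (f n) P := by
  intro n hn
  refine integrable_of_le_of_le (hf n hn).aestronglyMeasurable
    (Filter.Eventually.of_forall (hLf n hn)) (g₂ := fun ω => ∑ n ∈ s, f n ω -
      ∑ i ∈ s.erase n, L i ω) (Filter.Eventually.of_forall fun ω => ?_) (hL n hn)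
    (hsum.sub (integrable_finsetSum _ fun i hi => hL i (Finset.mem_of_mem_erase hi)))
  have h1 := Finset.add_sum_erase s (fun n => f n ω) hn
  have h2 : ∑ i ∈ s.erase n, L i ω ≤ ∑ i ∈ s.erase n, f i ω :=
    Finset.sum_le_sum fun i hi => hLf i (Finset.mem_of_mem_erase hi) ω
  dsimp only
  linarith

theorem truthful_optimal {q : ℝ} (hq0 : 0 ≤ q) (hq1 : q < 1) {N : ℕ} {K : Finset ℕ}
    (hK : K ⊆ Finset.Icc 1 N) {s : ℕ} (hs : s ≤ N) (r : ℕ → Option ℝ) (x : ℝ) (π : Policy N K)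
    (hneg : ∫⁻ ω, ENNReal.ofReal (-rewardFrom (faceValue q N) π s r ω) ∂(worldLaw q N x) ≠ ⊤) :
    Integrable (rewardFrom (faceValue q N) π s r) (worldLaw q N x) ∧
      (worldLaw q N x)[rewardFrom (faceValue q N) π s r | expertInfo N s] ≤ᵐ[worldLaw q N x]
        (worldLaw q N x)[rewardFrom (faceValue q N) (truthful hK) s r | expertInfo N s] := by
  set P := worldLaw q N x with hP
  set R := rewardFrom (faceValue q N) π s r with hR
  set R' := rewardFrom (faceValue q N) (truthful hK) s r with hR'
  have hRm : Measurable R := measurable_rewardFrom hq0 hq1 π hs r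
  have hR'i : Integrable R' P := integrable_rewardFrom_truthful hq0 hq1 hK hs r x
  let st : Policy N K → ℕ → World → ℝ × ℝ := fun ρ u ω =>
    marketState q N (fun i => marketSignal i ω) (record ρ s r ω) u
  let f : ℕ → World → ℝ := fun n ω =>
    nextScore (n + 1) (st (truthful hK) n ω) (marketSignal (n + 1) ω) (marketSignal n ω) -
      nextScore (n + 1) (st π n ω) (marketSignal (n + 1) ω) (marketSignal n ω)
  have hst (ρ : Policy N K) {n : ℕ} (hn : n ∈ Finset.range s) : Measurable (st ρ n) :=
    (measurable_marketState_record q ρ s r ((Finset.mem_range.1 hn).le.trans hs)).mono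
      (expertInfo_le N (n + 1)) le_rfl
  have hκ (ω : World) (n : ℕ) : (st π n ω).1 ∈ Set.Icc 0 (q / (1 - q)) :=
    marketState_fst_mem hq0 hq1 _ _ _ _
  have hsub (ω : World) : R' ω - R ω = ∑ n ∈ Finset.range s, f n ω :=
    rewardFrom_sub_rewardFrom hq0 hq1 (truthful hK) π hs r ω
  have hfm : ∀ n ∈ Finset.range s, Measurable (f n) := fun n hn => by
    have h1 := (hst π hn)
    have h2 := (hst (truthful hK) hn)
    have h (S : World → ℝ × ℝ) (hS : Measurable S) : Measurable fun ω =>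
        nextScore (n + 1) (S ω) (marketSignal (n + 1) ω) (marketSignal n ω) := by
      unfold nextScore; fun_prop
    exact (h _ h2).sub (h _ h1)
  -- Until the first allowed period of the continuation, both policies carry the inherited state and
  -- the gain vanishes; afterwards it is a truthful gain whose rival state is known at `k`.
  have hcases : ∀ n ∈ Finset.range s, f n = 0 ∨ ∃ k, n + 1 ≤ k ∧ k ≤ s ∧
      f n = truthGain q k n (st π n) ∧ Measurable[expertInfo N k] (st π n) := fun n hn => by
    rcases marketState_truthful_cases q hK π hs r (s - n) (u := n)
      (by have := Finset.mem_range.1 hn; omega) with h | ⟨k, h1, h2, h3, h4⟩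
    · left
      funext ω
      simp only [f, st, h, sub_self, Pi.zero_apply]
    · right
      refine ⟨k, h1, h2, ?_, h4⟩
      funext ω
      simp only [f, truthGain, st, h3]
  have hlow : ∀ n ∈ Finset.range s, ∃ L : World → ℝ, Integrable L P ∧ ∀ ω, L ω ≤ f n ω :=
    fun n hn => by
      rcases hcases n hn with h | ⟨k, h1, h2, h3, -⟩
      · exact ⟨0, integrable_zero _ _ _, fun ω => by simp [h]⟩
      · rw [h3]
        exact exists_integrable_le_truthGain hq0 hq1 x h1 (h2.trans hs) fun ω => hκ ω n
  choose! L hLi hLf using hlow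
  -- The lower bounds on the gains bound the rival reward above by an integrable function, so the
  -- hypothesis on its negative part makes it integrable.
  have hRle (ω : World) : R ω ≤ R' ω - ∑ n ∈ Finset.range s, L n ω := by
    have := Finset.sum_le_sum fun n hn => hLf n hn ω
    rw [← hsub] at this
    linarith
  have hRi : Integrable R P := by
    have hup : Integrable (fun ω => R' ω - ∑ n ∈ Finset.range s, L n ω) P :=
      hR'i.sub (integrable_finsetSum _ hLi)
    have hRneg : Integrable (fun ω => max (-R ω) 0) P := by
      refine ⟨(hRm.neg.max measurable_const).aestronglyMeasurable, ?_⟩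
      refine (hasFiniteIntegral_iff_ofReal (f := fun ω => max (-R ω) 0)
        (Filter.Eventually.of_forall fun ω => le_max_right (-R ω) 0)).2 ?_
      refine lt_of_le_of_lt (lintegral_mono fun ω => ?_) hneg.lt_top
      rcases le_total (-R ω) 0 with h | h
      · rw [max_eq_right h]; simp
      · rw [max_eq_left h]
    refine integrable_of_le_of_le hRm.aestronglyMeasurable (g₁ := fun ω => -max (-R ω) 0)
      (Filter.Eventually.of_forall fun ω => ?_) (Filter.Eventually.of_forall hRle) hRneg.neg hup
    have := le_max_left (-R ω) 0
    dsimp only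
    linarith
  refine ⟨hRi, ?_⟩
  have hfsum : Integrable (fun ω => ∑ n ∈ Finset.range s, f n ω) P :=
    (hR'i.sub hRi).congr (Filter.Eventually.of_forall hsub)
  have hfi := integrable_of_sum_le hfm hLi hLf hfsum
  have hpos : ∀ n ∈ Finset.range s, 0 ≤ᵐ[P] P[f n | expertInfo N s] := fun n hn => by
    rcases hcases n hn with h | ⟨k, h1, h2, h3, h4⟩
    · rw [h, condExp_zero]
    · have hi := hfi n hn
      rw [h3] at hi ⊢
      have h5 := condExp_truthGain_nonneg hq0 hq1 x h1 (h2.trans hs) (fun ω => hκ ω n) h4 hi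
      -- The gain is nonnegative in conditional mean at the finer joint information; as `k ≤ s`, the
      -- tower property carries this back to the expert's information at `s`.
      have h6 := condExp_condExp_of_le (μ := P) (f := truthGain q k n (st π n))
        ((expertInfo_anti (N := N) h2).trans (expertInfo_le_jointInfo N k (n + 1)))
        (jointInfo_le N k (n + 1))
      have h7 := condExp_mono (m := expertInfo N s) (integrable_zero _ _ _) integrable_condExp h5
      rw [condExp_zero] at h7
      exact h7.trans_eq h6
  have hs1 := condExp_finsetSum (m := expertInfo N s) hfi
  have hs2 := condExp_sub hR'i hRi (expertInfo N s)
  have e : R' - R = ∑ n ∈ Finset.range s, f n := by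
    funext ω
    rw [Pi.sub_apply, hsub, Finset.sum_apply]
  rw [e] at hs2
  have hpos' : ∀ᵐ ω ∂P, ∀ n ∈ Finset.range s, 0 ≤ (P[f n | expertInfo N s]) ω := by
    rw [Filter.eventually_all_finset]
    exact hpos
  filter_upwards [hs1, hs2, hpos'] with ω h1 h2 h3
  rw [h1, Finset.sum_apply, Pi.sub_apply] at h2
  have := Finset.sum_nonneg h3
  linarith

/-! ### Disintegration of the flat law -/

/-- For fixed steps, passing from the outcome to the first public signal is a translation, which
preserves Lebesgue measure. So that signal is again flat and independent of the steps. -/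
theorem lintegral_flatLaw (q : ℝ) (N : ℕ) (f : ℝ × World → ENNReal) (hf : Measurable f) :
    ∫⁻ ω, f (marketSignal N ω, ω) ∂(flatLaw q) =
      ∫⁻ x, ∫⁻ ω, f (x, ω) ∂(worldLaw q N x) := by
  let σ : (ℕ → ℝ) × (ℕ → ℝ) → ℝ := fun ab => ∑ i ∈ Finset.Icc 1 N, (ab.1 i + ab.2 i)
  have hσ : Measurable σ := by simp only [σ]; fun_prop
  have h1 : Measurable fun ω : World => f (marketSignal N ω, ω) :=
    hf.comp ((measurable_marketSignal N).prodMk measurable_id)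
  have h2 : Measurable fun p : ℝ × ((ℕ → ℝ) × (ℕ → ℝ)) => f (p.1, worldFrom N p.1 p.2) := by
    refine hf.comp (measurable_fst.prodMk ?_)
    exact (measurable_fst.sub (hσ.comp measurable_snd)).prodMk measurable_snd
  calc _ = ∫⁻ ab, (∫⁻ y : ℝ, f (marketSignal N (y, ab), (y, ab))) ∂(stepLaw q) := by
        rw [flatLaw, lintegral_prod_symm' _ h1]
    _ = ∫⁻ ab, (∫⁻ x : ℝ, f (x, worldFrom N x ab)) ∂(stepLaw q) := by
        refine lintegral_congr fun ab => ?_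
        rw [← lintegral_add_right_eq_self (fun x => f (x, worldFrom N x ab)) (σ ab)]
        refine lintegral_congr fun y => ?_
        simp [marketSignal, worldFrom, σ]
    _ = ∫⁻ x, ∫⁻ ab, f (x, worldFrom N x ab) ∂(stepLaw q) := by
        rw [lintegral_lintegral_swap (f := fun ab x => f (x, worldFrom N x ab))
          (h2.comp measurable_swap).aemeasurable]
    _ = _ := by
        refine lintegral_congr fun x => ?_
        exact (lintegral_map (hf.comp measurable_prodMk_left) (measurable_worldFrom N x)).symm

/-! ### Posteriors -/

theorem marketVar_eq {q : ℝ} (hq0 : 0 ≤ q) (hq1 : q < 1) {T t : ℕ} (ht : 1 ≤ t) (hT : 1 ≤ T) :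
    marketVar q T t = (t - (0 : ℕ)) * precDenom q T 0 / precDenom q T t := by
  have ht' : (0 : ℝ) < t := by exact_mod_cast ht
  have hT' : (0 : ℝ) < T := by exact_mod_cast hT
  have hq : 0 < 1 - q := by linarith
  have he := (precDenom_pos hq0 hq1 hT t).ne'
  rw [marketVar]
  unfold precDenom at he ⊢
  field_simp
  push_cast
  ring

theorem outcome_sub_marketMean {q : ℝ} (hq0 : 0 ≤ q) (hq1 : q < 1) {T t : ℕ} (ht : 1 ≤ t)
    (hT : 1 ≤ T) (ω : World) :
    outcome ω - marketMean q T t (expertSignal T ω) (marketSignal T ω) (marketSignal t ω) =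
      predError q T t 0 ω := by
  have ht' : (0 : ℝ) < t := by exact_mod_cast ht
  have hT' : (0 : ℝ) < T := by exact_mod_cast hT
  have hq : 0 < 1 - q := by linarith
  have he := (precDenom_pos hq0 hq1 hT t).ne'
  have h0 : marketSignal 0 ω = outcome ω := by simp [outcome, marketSignal]
  have e : 1 / (t : ℝ) + q / (1 - q) * (1 / T) = precDenom q T t / ((1 - q) * T * t) := by
    unfold precDenom
    field_simp
  rw [predError, marketMean, h0, e]
  congr 1
  unfold precDenom at he ⊢
  field_simp
  push_cast
  ring

theorem marketVar_pos {q : ℝ} (hq0 : 0 ≤ q) (hq1 : q < 1) {T t : ℕ} (ht : 1 ≤ t) :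
    0 < marketVar q T t := by
  have ht' : (0 : ℝ) < t := by exact_mod_cast ht
  have : 0 < 1 - q := by linarith
  unfold marketVar
  positivity

theorem expertVar_pos {q : ℝ} (hq1 : q < 1) {T : ℕ} (hT : 1 ≤ T) : 0 < expertVar q T := by
  have hT' : (0 : ℝ) < T := by exact_mod_cast hT
  exact mul_pos (by linarith) hT'

theorem marketVar_self {q : ℝ} (hq1 : q < 1) {T : ℕ} (hT : 1 ≤ T) :
    marketVar q T T = expertVar q T := by
  have hT' : (0 : ℝ) < T := by exact_mod_cast hT
  have hq : 1 - q ≠ 0 := by linarith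
  have e : 1 / (T : ℝ) + q / (1 - q) * (1 / T) = 1 / ((1 - q) * T) := by field_simp; ring
  rw [marketVar, expertVar, e, one_div_one_div]

theorem marketMean_self {q : ℝ} (hq1 : q < 1) {T : ℕ} (hT : 1 ≤ T) (z x : ℝ) :
    marketMean q T T z x x = z := by
  have hT' : (0 : ℝ) < T := by exact_mod_cast hT
  have hq : 1 - q ≠ 0 := by linarith
  have e : 1 / (T : ℝ) + q / (1 - q) * (1 / T) = 1 / ((1 - q) * T) := by field_simp; ring
  rw [marketMean, e]
  field_simp
  ring

theorem marketVar_le_expertVar {q : ℝ} (hq0 : 0 ≤ q) (hq1 : q < 1) {T t : ℕ} (ht : 1 ≤ t)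
    (htT : t ≤ T) : marketVar q T t ≤ expertVar q T := by
  rw [← marketVar_self hq1 (ht.trans htT), marketVar, marketVar]
  have ht' : (0 : ℝ) < t := by exact_mod_cast ht
  have hT' : (t : ℝ) ≤ T := by exact_mod_cast htT
  have : 0 < (T : ℝ) := ht'.trans_le hT'
  have : 0 < 1 - q := by linarith
  exact one_div_le_one_div_of_le (by positivity) (by gcongr)

/-- The posterior mean is a sufficient statistic: any smaller information that still determines it
yields the same posterior. Hence the market needs only truthful announcements, not the expert's full
signals. -/
theorem outcomeGiven_eq_of_le_jointInfo {q : ℝ} (hq0 : 0 ≤ q) (hq1 : q < 1) {N T t : ℕ} (x : ℝ)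
    (ht : 1 ≤ t) (htT : t ≤ T) (hTN : T ≤ N) {m : MeasurableSpace World} (hm : m ≤ jointInfo N T t)
    (hmean : Measurable[m] fun ω =>
      marketMean q T t (expertSignal T ω) (marketSignal T ω) (marketSignal t ω)) :
    ∀ᵐ ω ∂(worldLaw q N x), outcomeGiven q N x m ω =
      gaussianReal (marketMean q T t (expertSignal T ω) (marketSignal T ω) (marketSignal t ω))
        (marketVar q T t).toNNReal := by
  have hT : 1 ≤ T := ht.trans htT
  have e : (fun ω => outcome ω - marketMean q T t (expertSignal T ω) (marketSignal T ω)
      (marketSignal t ω)) = predError q T t 0 :=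
    funext fun ω => outcome_sub_marketMean hq0 hq1 ht hT ω
  refine map_condExpKernel_eq_gaussianReal (mΩ := Prod.instMeasurableSpace) (hm.trans (jointInfo_le N T t)) measurable_outcome
    hmean ?_ ?_
  · rw [e]
    exact indep_of_indep_of_le_left (indep_predError hq0 hq1 x hT (Nat.zero_le t) htT hTN) hm
  · rw [e, map_predError hq0 hq1 x hT (Nat.zero_le t) htT hTN, marketVar_eq hq0 hq1 ht hT]

theorem outcomeGiven_eq_of_le_marketInfo {q : ℝ} (hq0 : 0 ≤ q) (hq1 : q < 1) {N t : ℕ} (x : ℝ)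
    (htN : t ≤ N) {m : MeasurableSpace World} (hm : m ≤ jointInfo N (N + 1) t)
    (hmean : Measurable[m] (marketSignal t)) :
    ∀ᵐ ω ∂(worldLaw q N x), outcomeGiven q N x m ω = gaussianReal (marketSignal t ω) t :=
  map_condExpKernel_eq_gaussianReal (mΩ := Prod.instMeasurableSpace) (hm.trans (jointInfo_le N (N + 1) t))
    measurable_outcome hmean
    (indep_of_indep_of_le_left (indep_outcome_sub_marketSignal hq0 hq1 x htN) hm)
    (map_outcome_sub_marketSignal hq0 hq1 x htN)

theorem measurable_marketMean {Ω : Type*} {_ : MeasurableSpace Ω} (q : ℝ) (T t : ℕ)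
    {z xT xt : Ω → ℝ} (hz : Measurable z) (hxT : Measurable xT) (hxt : Measurable xt) :
    Measurable fun ω => marketMean q T t (z ω) (xT ω) (xt ω) := by
  unfold marketMean; fun_prop

theorem outcomeGiven_expertInfo {q : ℝ} (hq0 : 0 ≤ q) (hq1 : q < 1) {N t : ℕ} (x : ℝ)
    (ht : 1 ≤ t) (htN : t ≤ N) :
    ∀ᵐ ω ∂(worldLaw q N x), outcomeGiven q N x (expertInfo N t) ω =
      gaussianReal (expertSignal t ω) (expertVar q t).toNNReal := by
  have hX := measurable_marketSignal_expertInfo (N := N) (le_refl t) htN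
  have h := outcomeGiven_eq_of_le_jointInfo hq0 hq1 x ht le_rfl htN
    (expertInfo_le_jointInfo N t t)
    (measurable_marketMean q t t (measurable_expertSignal N t htN) hX hX)
  simpa only [marketMean_self hq1 ht, marketVar_self hq1 ht] using h

theorem measurable_marketSignal_publicInfo {N : ℕ} {K : Finset ℕ} (π : Policy N K) {t u i : ℕ}
    (hi : t ≤ i) (hN : i ≤ N) : Measurable[publicInfo π t u] (marketSignal i) := by
  have h : MeasurableSpace.comap (marketSignal i) inferInstance ≤ publicInfo π t u :=
    (le_iSup₂_of_le (f := fun i (_ : i ∈ Finset.Icc t N) =>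
      MeasurableSpace.comap (marketSignal i) inferInstance) i (by simp [hi, hN]) le_rfl).trans
      le_sup_left
  exact (comap_measurable (marketSignal i)).mono h le_rfl

theorem measurable_act_publicInfo {N : ℕ} {K : Finset ℕ} (π : Policy N K) {t u i : ℕ}
    (hi : u ≤ i) (hN : i ≤ N) : Measurable[publicInfo π t u] fun ω => encode (π.act i ω) := by
  have h : MeasurableSpace.comap (fun ω => encode (π.act i ω)) inferInstance ≤ publicInfo π t u :=
    (le_iSup₂_of_le (f := fun i (_ : i ∈ Finset.Icc u N) =>
      MeasurableSpace.comap (fun ω => encode (π.act i ω)) inferInstance) i (by simp [hi, hN])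
      le_rfl).trans le_sup_right
  exact (comap_measurable _).mono h le_rfl

/-- Truthful announcements reveal nothing beyond the expert's information at the latest of them, and
silence at forbidden periods is uninformative. -/
theorem publicInfo_truthful_le {N k t u : ℕ} {K : Finset ℕ} (hK : K ⊆ Finset.Icc 1 N)
    (h : ∀ i ∈ K, u ≤ i → k ≤ i) : publicInfo (truthful hK) t u ≤ jointInfo N k t := by
  refine sup_le le_sup_right ((iSup₂_le fun i hi => Measurable.comap_le ?_).trans le_sup_left)
  have hi' := Finset.mem_Icc.1 hi
  by_cases hiK : i ∈ K
  · exact ((truthful hK).measurable i).mono (expertInfo_anti (h i hiK hi'.1)) le_rfl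
  · simp only [(truthful hK).silent i hiK]
    exact measurable_const

theorem outcomeGiven_publicInfo_truthful {q : ℝ} (hq0 : 0 ≤ q) (hq1 : q < 1) {N T t u : ℕ}
    {K : Finset ℕ} (hK : K ⊆ Finset.Icc 1 N) (x : ℝ) (ht : 1 ≤ t) (htT : t ≤ T) (huT : u ≤ T)
    (hT : T ∈ K) (h : ∀ i ∈ K, u ≤ i → T ≤ i) :
    ∀ᵐ ω ∂(worldLaw q N x), outcomeGiven q N x (publicInfo (truthful hK) t u) ω =
      gaussianReal (marketMean q T t (expertSignal T ω) (marketSignal T ω) (marketSignal t ω))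
        (marketVar q T t).toNNReal := by
  have hTN : T ≤ N := (Finset.mem_Icc.1 (hK hT)).2
  refine outcomeGiven_eq_of_le_jointInfo hq0 hq1 x ht htT hTN (publicInfo_truthful_le hK h)
    (measurable_marketMean q T t ?_ (measurable_marketSignal_publicInfo _ htT hTN)
      (measurable_marketSignal_publicInfo _ le_rfl (htT.trans hTN)))
  have := (measurable_act_publicInfo (truthful hK) (t := t) huT hTN).snd
  simpa [truthful, hT, encode] using this

theorem outcomeGiven_publicInfo_truthful_of_silent {q : ℝ} (hq0 : 0 ≤ q) (hq1 : q < 1) {N t u : ℕ}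
    {K : Finset ℕ} (hK : K ⊆ Finset.Icc 1 N) (x : ℝ) (htN : t ≤ N) (h : ∀ i ∈ K, i < u) :
    ∀ᵐ ω ∂(worldLaw q N x), outcomeGiven q N x (publicInfo (truthful hK) t u) ω =
      gaussianReal (marketSignal t ω) t :=
  outcomeGiven_eq_of_le_marketInfo hq0 hq1 x htN
    (publicInfo_truthful_le hK fun i hi hu => absurd (h i hi) (by omega))
    (measurable_marketSignal_publicInfo _ le_rfl htN)

theorem withDensity_gaussianPDFReal (m : ℝ) {v : NNReal} (hv : v ≠ 0) :
    (volume.withDensity fun y => ENNReal.ofReal (gaussianPDFReal m v y)) = gaussianReal m v :=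
  (gaussianReal_of_var_ne_zero m hv).symm

/-- The market's prior density under the truthful policy is the posterior density given the public
information before, or after, a period. -/
theorem bayes_faceValueBefore {q : ℝ} (hq0 : 0 ≤ q) (hq1 : q < 1) {N t u : ℕ}
    {K : Finset ℕ} (hK : K ⊆ Finset.Icc 1 N) (x : ℝ) (ht : 1 ≤ t) (htN : t ≤ N)
    (hu : ∀ i ∈ K, u ≤ i ↔ t < i) :
    ∀ᵐ ω ∂(worldLaw q N x), outcomeGiven q N x (publicInfo (truthful hK) t u) ω =
      volume.withDensity fun y => ENNReal.ofReal (faceValueBefore q N t (fun i => marketSignal i ω)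
        (fun i => (truthful hK).act i ω) y) := by
  by_cases hex : ∃ i, i ∈ K ∧ t < i
  · classical
    -- Time runs backwards, so the latest prediction before `t` is at the smallest element of `K`
    -- above `t`.
    obtain ⟨hT, htT⟩ := Nat.find_spec hex
    have hmin {i : ℕ} (hi : i < Nat.find hex) := Nat.find_min hex hi
    set T := Nat.find hex
    have hTN : T ≤ N := (Finset.mem_Icc.1 (hK hT)).2
    filter_upwards [outcomeGiven_publicInfo_truthful hq0 hq1 hK x ht htT.le ((hu T hT).2 htT) hT
      fun i hi hui => not_lt.1 fun h => hmin h ⟨hi, (hu i hi).1 hui⟩] with ω hω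
    have hl : latest (fun i => (truthful hK).act i ω) t (N - t) = some (T, expertSignal T ω) :=
      latest_eq_some (by simp [truthful, hT]) _ _ htT (by omega) fun i hi hiT =>
        (truthful hK).silent i (fun hiK => hmin hiT ⟨hiK, hi⟩) ω
    rw [hω]
    simp only [faceValueBefore, hl]
    rw [withDensity_gaussianPDFReal]
    rw [Ne, Real.toNNReal_eq_zero, not_le]
    exact marketVar_pos hq0 hq1 ht
  · push Not at hex
    filter_upwards [outcomeGiven_publicInfo_truthful_of_silent hq0 hq1 hK x htN fun i hi =>
      not_le.1 fun h => absurd ((hu i hi).1 h) (hex i hi).not_gt] with ω hω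
    have hl : latest (fun i => (truthful hK).act i ω) t (N - t) = none :=
      latest_eq_none _ _ fun i hi _ => (truthful hK).silent i
        (fun hiK => absurd hi (hex i hiK).not_gt) ω
    rw [hω]
    simp only [faceValueBefore, hl]
    rw [withDensity_gaussianPDFReal]
    exact_mod_cast (by omega : t ≠ 0)

theorem isEquilibrium_truthful {q : ℝ} (hq0 : 0 ≤ q) (hq1 : q < 1) (N : ℕ) {K : Finset ℕ}
    (hK : K ⊆ Finset.Icc 1 N) (x : ℝ) :
    IsEquilibrium q N K x (truthful hK) (faceValue q N) where
  bayes_before t ht := by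
    obtain ⟨ht1, htN⟩ := Finset.mem_Icc.1 ht
    exact bayes_faceValueBefore hq0 hq1 hK x ht1 htN fun i _ => Iff.rfl
  bayes_after t ht := by
    obtain ⟨ht1, htN⟩ := Finset.mem_Icc.1 ht
    by_cases htK : t ∈ K
    · filter_upwards [outcomeGiven_publicInfo_truthful hq0 hq1 hK x ht1 le_rfl le_rfl htK
        fun i _ hi => hi] with ω hω
      rw [hω, marketMean_self hq1 ht1, marketVar_self hq1 ht1]
      simp only [faceValue, truthful, htK, if_true]
      rw [withDensity_gaussianPDFReal]
      rw [Ne, Real.toNNReal_eq_zero, not_le]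
      exact expertVar_pos hq1 ht1
    · filter_upwards [bayes_faceValueBefore hq0 hq1 hK x ht1 htN (u := t) fun i hi =>
        ⟨fun h => lt_of_le_of_ne h (by rintro rfl; exact htK hi), le_of_lt⟩] with ω hω
      rw [hω]
      simp only [faceValue, (truthful hK).silent t htK]
  integrable s hs r := integrable_rewardFrom_truthful hq0 hq1 hK (Finset.mem_Icc.1 hs).2 r x
  optimal s hs r π hneg := truthful_optimal hq0 hq1 hK (Finset.mem_Icc.1 hs).2 r x π hneg

/-! ### The effect of a misreport -/

theorem marketMean_add (q : ℝ) (T t : ℕ) (z c xT xt : ℝ) :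
    marketMean q T t (z + c) xT xt =
      marketMean q T t z xT xt + marketVar q T t / expertVar q T * c := by
  simp only [marketMean, marketVar, expertVar, div_eq_mul_inv, mul_inv]
  ring

theorem faceValueBefore_update (q : ℝ) {N t T : ℕ} (htT : t < T) (hTN : T ≤ N) (xs : ℕ → ℝ)
    (r : ℕ → Option ℝ) (w : ℝ) (hr : ∀ i, t < i → i < T → r i = none) :
    faceValueBefore q N t xs (Function.update r T (some w)) =
      gaussianPDFReal (marketMean q T t w (xs T) (xs t)) (marketVar q T t).toNNReal := by
  have hl : latest (Function.update r T (some w)) t (N - t) = some (T, w) :=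
    latest_eq_some (Function.update_self T _ r) _ _ htT (by omega) fun i hi hiT => by
      rw [Function.update_of_ne hiT.ne]; exact hr i hi hiT
  simp only [faceValueBefore, hl]

/-! ### Change of the total reward caused by a misreport -/

theorem marketState_of_latest {q : ℝ} {N : ℕ} {x : ℕ → ℝ} {r : ℕ → Option ℝ} {u T : ℕ} {z : ℝ}
    (hT : r T = some z) (huT : u < T) (hTN : T ≤ N) (hr : ∀ i, u < i → i < T → r i = none) :
    marketState q N x r u = predictionState q T z (x T) := by
  rw [marketState, latest_eq_some hT _ _ huT (by omega) hr]

/-- A prediction at `τ` overwrites the state, so an earlier misreport leaves no trace after it. -/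
theorem marketState_eq_of_isSome {q : ℝ} {N : ℕ} {x : ℕ → ℝ} {r r' : ℕ → Option ℝ} {τ : ℕ}
    (hτN : τ ≤ N) (hτ : (r τ).isSome) (n : ℕ) {u : ℕ} (hu : u + (n + 1) = τ)
    (h : ∀ i, u < i → i ≤ τ → r i = r' i) : marketState q N x r u = marketState q N x r' u := by
  induction n generalizing u with
  | zero =>
    obtain rfl : u + 1 = τ := by omega
    obtain ⟨z, hz⟩ := Option.isSome_iff_exists.1 hτ
    rw [marketState_of_some (by omega) hz,
      marketState_of_some (by omega) ((h (u + 1) (by omega) le_rfl).symm.trans hz)]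
  | succ n ih =>
    rw [marketState_eq_ite (by omega), marketState_eq_ite (r := r') (by omega),
      h (u + 1) (by omega) (by omega), ih (u := u + 1) (by omega) fun i hi => h i (by omega)]

/-- The two records give different states only from just after the action at `T` to just before the
one at `τ`. Within this stretch each reward is the difference of equal terms, so only the two ends
survive. -/
theorem sum_logScore_misreport {q : ℝ} {N τ T : ℕ} (hτ1 : 1 ≤ τ) (hτT : τ < T) (hTN : T ≤ N)
    (x : ℕ → ℝ) (y : ℝ) {r r' : ℕ → Option ℝ} {z z' : ℝ} (hr : r T = some z) (hr' : r' T = some z')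
    (hrr' : ∀ i, i ≠ T → r i = r' i) (hτ : (r τ).isSome)
    (hn : ∀ i, τ < i → i < T → r i = none) :
    ∑ n ∈ Finset.range N,
        (logScore (n + 1) (marketState q N x r' n) (x (n + 1)) y -
          logScore (n + 1) (marketState q N x r' (n + 1)) (x (n + 1)) y) -
      ∑ n ∈ Finset.range N,
        (logScore (n + 1) (marketState q N x r n) (x (n + 1)) y -
          logScore (n + 1) (marketState q N x r (n + 1)) (x (n + 1)) y) =
      (logScore T (predictionState q T z' (x T)) (x T) y -
        logScore T (predictionState q T z (x T)) (x T) y) -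
      (logScore τ (predictionState q T z' (x T)) (x τ) y -
        logScore τ (predictionState q T z (x T)) (x τ) y) := by
  have hlate (u : ℕ) (hTu : T ≤ u) (hu : u ≤ N) :
      marketState q N x r u = marketState q N x r' u :=
    marketState_congr hu fun i hi => hrr' i (by have := (Finset.mem_Ioc.1 hi).1; omega)
  have hearly (u : ℕ) (hu : u < τ) : marketState q N x r u = marketState q N x r' u :=
    marketState_eq_of_isSome (by omega) hτ (τ - u - 1) (by omega) fun i _ hi => hrr' i (by omega)
  have hmid (u : ℕ) (hu : τ ≤ u) (huT : u < T) :
      marketState q N x r u = predictionState q T z (x T) :=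
    marketState_of_latest hr huT hTN fun i hi hiT => hn i (by omega) hiT
  have hmid' (u : ℕ) (hu : τ ≤ u) (huT : u < T) :
      marketState q N x r' u = predictionState q T z' (x T) :=
    marketState_of_latest hr' huT hTN fun i hi hiT => by
      rw [← hrr' i (by omega)]; exact hn i (by omega) hiT
  set A := logScore T (predictionState q T z' (x T)) (x T) y -
        logScore T (predictionState q T z (x T)) (x T) y
  set B := logScore τ (predictionState q T z' (x T)) (x τ) y -
        logScore τ (predictionState q T z (x T)) (x τ) y
  rw [← Finset.sum_sub_distrib]
  have key : ∀ n ∈ Finset.range N,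
      (logScore (n + 1) (marketState q N x r' n) (x (n + 1)) y -
          logScore (n + 1) (marketState q N x r' (n + 1)) (x (n + 1)) y) -
        (logScore (n + 1) (marketState q N x r n) (x (n + 1)) y -
          logScore (n + 1) (marketState q N x r (n + 1)) (x (n + 1)) y) =
      (if n = T - 1 then A else 0) - (if n = τ - 1 then B else 0) := by
    intro n hnN
    have hnN := Finset.mem_range.1 hnN
    rcases lt_trichotomy (n + 1) τ with h | h | h
    · rw [if_neg (by omega), if_neg (by omega), hearly n (by omega), hearly (n + 1) h]
      ring
    · rw [if_neg (by omega), if_pos (by omega), hearly n (by omega), hmid (n + 1) h.ge (by omega),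
        hmid' (n + 1) h.ge (by omega), h]
      simp only [B]
      ring
    · rcases lt_trichotomy (n + 1) T with h' | h' | h'
      · rw [if_neg (by omega), if_neg (by omega), hmid n (by omega) (by omega),
          hmid' n (by omega) (by omega), hmid (n + 1) (by omega) h', hmid' (n + 1) (by omega) h']
        ring
      · rw [if_pos (by omega), if_neg (by omega), hmid n (by omega) (by omega),
          hmid' n (by omega) (by omega), hlate (n + 1) h'.ge (by omega), h']
        simp only [A]
        ring
      · rw [if_neg (by omega), if_neg (by omega), hlate n (by omega) (by omega),
          hlate (n + 1) (by omega) (by omega)]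
        ring
  rw [Finset.sum_congr rfl key, Finset.sum_sub_distrib, Finset.sum_ite_eq', Finset.sum_ite_eq',
    if_pos (Finset.mem_range.2 (by omega)), if_pos (Finset.mem_range.2 (by omega))]

/-- Shifting the mean of a Gaussian density is an exponential tilt. As the mean shifts in proportion
to the market variance, the tilt `c / expertVar q T` is the same at every `t`, and only the
normalising term depends on the variance. -/
theorem logScore_predictionState_add {q : ℝ} (hq0 : 0 ≤ q) (hq1 : q < 1) {T t : ℕ} (ht : 1 ≤ t)
    (z c xT xt y : ℝ) :
    logScore t (predictionState q T (z + c) xT) xt y - logScore t (predictionState q T z xT) xt y =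
      c / expertVar q T * (y - marketMean q T t z xT xt) -
        marketVar q T t * (c / expertVar q T) ^ 2 / 2 := by
  have hv := marketVar_pos hq0 hq1 (T := T) ht
  have e (z : ℝ) : logScore t (predictionState q T z xT) xt y =
      Real.log (gaussianPDFReal (marketMean q T t z xT xt) (marketVar q T t).toNNReal y) := by
    simp only [logScore, stateDensity, predictionState, marketMean, marketVar]
    congr 3
    ring
  rw [e, e, log_gaussianPDFReal _ hv, log_gaussianPDFReal _ hv, marketMean_add,
    show marketVar q T t / expertVar q T * c = marketVar q T t * (c / expertVar q T) by ring]
  generalize c / expertVar q T = d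
  field_simp
  ring

theorem totalReward_misreport_sub {q : ℝ} (hq0 : 0 ≤ q) (hq1 : q < 1) {N : ℕ} {K : Finset ℕ}
    (hK : K ⊆ Finset.Icc 1 N) (π : Policy N K) {T : ℕ} (hT : T ∈ K) {c : World → ℝ}
    (hc : Measurable[expertInfo N T] c) (h0 : Measurable[expertInfo N T] fun _ : World => (0 : ℝ))
    (ω : World) {τ : ℕ} (hτ1 : 1 ≤ τ) (hτT : τ < T) (hτ : (π.act τ ω).isSome)
    (hn : ∀ i, τ < i → i < T → π.act i ω = none) :
    totalReward (faceValue q N) (π.misreport hK T hT c hc) ω -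
        totalReward (faceValue q N) (π.misreport hK T hT (fun _ => 0) h0) ω =
      c ω / expertVar q T * predError q T T 0 ω - c ω / expertVar q T * predError q T τ 0 ω -
        (c ω ^ 2 / (2 * expertVar q T) - marketVar q T τ * (c ω / expertVar q T) ^ 2 / 2) := by
  have hT' := Finset.mem_Icc.1 (hK hT)
  have hev := expertVar_pos hq1 hT'.1
  have hact (c : World → ℝ) (hc : Measurable[expertInfo N T] c) (i : ℕ) (hi : i ≠ T)
      (hiN : i ≤ N) : record (π.misreport hK T hT c hc) N (fun _ => none) ω i = π.act i ω := by
    simp [record, hiN, Policy.misreport, hi]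
  have hactT (c : World → ℝ) (hc : Measurable[expertInfo N T] c) :
      record (π.misreport hK T hT c hc) N (fun _ => none) ω T =
        some (expertSignal T ω + c ω) := by
    simp [record, hT'.2, Policy.misreport]
  rw [totalReward, totalReward, rewardFrom_eq_sum hq0 hq1 _ le_rfl,
    rewardFrom_eq_sum hq0 hq1 _ le_rfl, sum_logScore_misreport hτ1 hτT hT'.2
      (fun i => marketSignal i ω) _ ((hactT _ h0).trans (by rw [add_zero])) (hactT _ hc) ?_ ?_ ?_,
    logScore_predictionState_add hq0 hq1 hT'.1, logScore_predictionState_add hq0 hq1 hτ1,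
    outcome_sub_marketMean hq0 hq1 hT'.1 hT'.1, outcome_sub_marketMean hq0 hq1 hτ1 hT'.1,
    marketVar_self hq1 hT'.1]
  · field_simp
    ring
  · intro i hi
    by_cases hiN : i ≤ N
    · rw [hact _ h0 i hi hiN, hact _ hc i hi hiN]
    · simp [record, hiN]
  · rw [hact _ h0 τ hτT.ne (by omega)]; exact hτ
  · intro i hi hiT
    rw [hact _ h0 i hiT.ne (by omega)]; exact hn i hi hiT

/-- The factor may depend on public signals after `T`, so independence is used at the joint
information up to `t`, and the tower property leads back to `T`. -/
theorem condExp_mul_predError {q : ℝ} (hq0 : 0 ≤ q) (hq1 : q < 1) {N T t : ℕ} (x : ℝ)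
    (hT : 1 ≤ T) (htT : t ≤ T) (hTN : T ≤ N) {h : World → ℝ}
    (hh : Measurable[jointInfo N T t] h) (h2 : MemLp h 2 (worldLaw q N x)) :
    (worldLaw q N x)[fun ω => h ω * predError q T t 0 ω | expertInfo N T] =ᵐ[worldLaw q N x] 0 := by
  have hD2 := memLp_predError hq0 hq1 x hT (Nat.zero_le t) htT hTN
  have h1 := condExp_mul_comp_eq_zero (jointInfo_le N T t) (g := fun d => d)
    (measurable_predError q T t 0) (indep_predError hq0 hq1 x hT (Nat.zero_le t) htT hTN) hh
    measurable_id (hD2.integrable one_le_two) (integral_eq_zero_of_map_gaussianReal (by fun_prop)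
      (map_predError hq0 hq1 x hT (Nat.zero_le t) htT hTN)) (h2.integrable_mul hD2)
  have h3 := condExp_condExp_of_le (μ := worldLaw q N x)
    (f := fun ω => h ω * predError q T t 0 ω) (expertInfo_le_jointInfo N T t) (jointInfo_le N T t)
  have h4 := condExp_congr_ae (m := expertInfo N T) h1
  rw [condExp_zero] at h4
  exact h3.symm.trans h4

/-- The linear terms average out even at the random time `τ`, which leaves the two quadratic terms.
They compare pathwise, because the market variance at `τ` is at most the expert's at `T`. -/
theorem misreport_gain {q : ℝ} (hq0 : 0 ≤ q) (hq1 : q < 1) {N : ℕ} {K : Finset ℕ}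
    (hK : K ⊆ Finset.Icc 1 N) (x : ℝ) (π : Policy N K) {T : ℕ} (hT : T ∈ K) {τ : World → ℕ}
    (hτT : ∀ ω, 1 ≤ τ ω ∧ τ ω < T) (hτ : ∀ ω, (π.act (τ ω) ω).isSome)
    (hn : ∀ ω i, τ ω < i → i < T → π.act i ω = none)
    (hτm : ∀ t, MeasurableSet[jointInfo N T t] {ω | τ ω = t})
    {c : World → ℝ} (hc : Measurable[expertInfo N T] c)
    (h0 : Measurable[expertInfo N T] fun _ : World => (0 : ℝ)) (hc2 : MemLp c 2 (worldLaw q N x)) :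
    let ΔW : World → ℝ := fun ω =>
      totalReward (faceValue q N) (π.misreport hK T hT c hc) ω -
      totalReward (faceValue q N) (π.misreport hK T hT (fun _ => 0) h0) ω
    let cτ : World → ℝ := fun ω => marketVar q T (τ ω) / expertVar q T * c ω
    Integrable ΔW (worldLaw q N x) ∧
    Integrable (fun ω => cτ ω ^ 2 / (2 * marketVar q T (τ ω))) (worldLaw q N x) ∧
    (worldLaw q N x)[ΔW | expertInfo N T] =ᵐ[worldLaw q N x]
      (fun ω => ((worldLaw q N x)[fun ω => cτ ω ^ 2 / (2 * marketVar q T (τ ω)) |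
        expertInfo N T]) ω - c ω ^ 2 / (2 * expertVar q T)) ∧
    (worldLaw q N x)[ΔW | expertInfo N T] ≤ᵐ[worldLaw q N x] 0 := by
  intro ΔW cτ
  obtain ⟨hT1, hTN⟩ := Finset.mem_Icc.1 (hK hT)
  have hev := expertVar_pos hq1 hT1
  have hvpos (ω : World) : 0 < marketVar q T (τ ω) := marketVar_pos hq0 hq1 (hτT ω).1
  have hvle (ω : World) : marketVar q T (τ ω) ≤ expertVar q T :=
    marketVar_le_expertVar hq0 hq1 (hτT ω).1 (hτT ω).2.le
  set P := worldLaw q N x with hP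
  let δ : World → ℝ := fun ω => c ω / expertVar q T
  have hδm : Measurable[expertInfo N T] δ := hc.div_const _
  have hδm' : Measurable δ := hδm.mono (expertInfo_le N T) le_rfl
  have hδ2 : MemLp δ 2 P := by
    simpa only [δ, div_eq_mul_inv] using hc2.mul_const (expertVar q T)⁻¹
  have hτmeas : Measurable τ := measurable_to_countable' fun t => jointInfo_le N T t _ (hτm t)
  have hvm : Measurable fun ω => marketVar q T (τ ω) :=
    (measurable_from_nat (f := fun t => marketVar q T t)).comp hτmeas
  -- the two quadratic terms
  let U : World → ℝ := fun ω => cτ ω ^ 2 / (2 * marketVar q T (τ ω))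
  let V : World → ℝ := fun ω => c ω ^ 2 / (2 * expertVar q T)
  have hU (ω : World) : U ω = marketVar q T (τ ω) / 2 * δ ω ^ 2 := by
    have := (hvpos ω).ne'
    simp only [U, cτ, δ]
    field_simp
  have hUi : Integrable U P := by
    refine (integrable_bdd_mul hδ2.integrable_sq (hvm.div_const 2) (expertVar q T / 2)
      fun ω => ?_).congr (Filter.Eventually.of_forall fun ω => (hU ω).symm)
    rw [abs_of_pos (half_pos (hvpos ω))]
    linarith [hvle ω]
  have hVi : Integrable V P := hc2.integrable_sq.div_const _
  have hUV (ω : World) : U ω ≤ V ω := by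
    have e : V ω = expertVar q T / 2 * δ ω ^ 2 := by
      simp only [V, δ]
      field_simp
    rw [hU, e]
    exact mul_le_mul_of_nonneg_right (by linarith [hvle ω]) (sq_nonneg _)
  -- the linear terms
  let L₁ : World → ℝ := fun ω => δ ω * predError q T T 0 ω
  -- Splitting by the value of `τ` makes each piece known at the corresponding fixed period, where
  -- the prediction error is independent of it.
  let g : ℕ → World → ℝ := fun t => {ω | τ ω = t}.indicator δ
  have hgm (t : ℕ) : Measurable[jointInfo N T t] (g t) :=
    (hδm.mono (expertInfo_le_jointInfo N T t) le_rfl).indicator (hτm t)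
  have hg2 (t : ℕ) : MemLp (g t) 2 P := hδ2.indicator (jointInfo_le N T t _ (hτm t))
  let M : ℕ → World → ℝ := fun t ω => g t ω * predError q T t 0 ω
  have hMi : ∀ t ∈ Finset.range T, Integrable (M t) P := fun t ht =>
    (hg2 t).integrable_mul (memLp_predError hq0 hq1 x hT1 (Nat.zero_le t)
      (Finset.mem_range.1 ht).le hTN)
  have hL₁i : Integrable L₁ P :=
    hδ2.integrable_mul (memLp_predError hq0 hq1 x hT1 (Nat.zero_le T) le_rfl hTN)
  have hM (ω : World) : ∑ t ∈ Finset.range T, M t ω = δ ω * predError q T (τ ω) 0 ω := by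
    rw [Finset.sum_eq_single_of_mem (τ ω) (Finset.mem_range.2 (hτT ω).2)]
    · simp [M, g]
    · intro t _ ht
      simp [M, g, ht.symm]
  have hΔ : ΔW = L₁ - ∑ t ∈ Finset.range T, M t - (V - U) := by
    funext ω
    simp only [Pi.sub_apply, Finset.sum_apply, hM, hU, V, L₁, δ]
    refine (totalReward_misreport_sub hq0 hq1 hK π hT hc h0 ω (hτT ω).1 (hτT ω).2 (hτ ω)
      (hn ω)).trans ?_
    ring
  have hMsum : Integrable (∑ t ∈ Finset.range T, M t) P := integrable_finsetSum' _ hMi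
  have hΔi : Integrable ΔW P := by
    rw [hΔ]; exact (hL₁i.sub hMsum).sub (hVi.sub hUi)
  have hVm : P[V | expertInfo N T] = V :=
    condExp_of_stronglyMeasurable (expertInfo_le N T)
      ((hc.pow_const 2).div_const _).stronglyMeasurable hVi
  have c1 : P[L₁ | expertInfo N T] =ᵐ[P] 0 := condExp_mul_predError hq0 hq1 x hT1 le_rfl hTN
    (hδm.mono (expertInfo_le_jointInfo N T T) le_rfl) hδ2
  have c2 : ∀ᵐ ω ∂P, ∀ t ∈ Finset.range T, (P[M t | expertInfo N T]) ω = 0 := by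
    rw [Filter.eventually_all_finset]
    exact fun t ht => condExp_mul_predError hq0 hq1 x hT1 (Finset.mem_range.1 ht).le hTN
      (hgm t) (hg2 t)
  have heq : P[ΔW | expertInfo N T] =ᵐ[P] fun ω => (P[U | expertInfo N T]) ω - V ω := by
    rw [hΔ]
    filter_upwards [condExp_sub (hL₁i.sub hMsum) (hVi.sub hUi) (expertInfo N T),
      condExp_sub hL₁i hMsum (expertInfo N T), condExp_sub hVi hUi (expertInfo N T),
      condExp_finsetSum (m := expertInfo N T) hMi, c1, c2] with ω h1 h2 h3 h4 h5 h6
    rw [h1, Pi.sub_apply, h2, Pi.sub_apply, h3, Pi.sub_apply, h4, Finset.sum_apply,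
      Finset.sum_eq_zero h6, h5, hVm]
    simp
  refine ⟨hΔi, hUi, heq, ?_⟩
  have hmono := condExp_mono (m := expertInfo N T) hUi hVi (Filter.Eventually.of_forall hUV)
  rw [hVm] at hmono
  filter_upwards [heq, hmono] with ω h1 h2
  rw [h1, Pi.zero_apply]
  linarith

theorem proposition4 (q : ℝ) (hq0 : 0 ≤ q) (hq1 : q < 1) (N : ℕ) (K : Finset ℕ)
    (hK : K ⊆ Finset.Icc 1 N) :
    -- `worldLaw` is the conditional law, under the flat prior, given the first public signal
    (∀ f : ℝ × World → ENNReal, Measurable f →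
      ∫⁻ ω, f (marketSignal N ω, ω) ∂(flatLaw q) = ∫⁻ x, ∫⁻ ω, f (x, ω) ∂(worldLaw q N x)) ∧
    ∀ x : ℝ,
      -- the expert's belief at `t` is `N(y_t, (1 - q) t)`, so announcing `y_t` is truthful
      (∀ t ∈ Finset.Icc 1 N, ∀ᵐ ω ∂(worldLaw q N x),
        outcomeGiven q N x (expertInfo N t) ω =
          gaussianReal (expertSignal t ω) (expertVar q t).toNNReal) ∧
      -- truthful predictions and a market that takes them at face value are an equilibrium
      IsEquilibrium q N K x (truthful hK) (faceValue q N) ∧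
      -- a misreport by `c` at `T` shifts the market mean at `t`, the next prediction, by a
      -- deterministic multiple of `c`, and leaves the variance unchanged
      (∀ t T : ℕ, 1 ≤ t → t < T → T ≤ N → ∀ (xs : ℕ → ℝ) (r : ℕ → Option ℝ) (z : ℝ),
        r T = some z → (∀ i, t < i → i < T → r i = none) →
        ∃ m : ℝ, ∀ c : ℝ,
          (faceValue q N).before t xs (Function.update r T (some (z + c))) =
            gaussianPDFReal (m + marketVar q T t / expertVar q T * c)
              (marketVar q T t).toNNReal) ∧
      -- the expected net gain from a misreport by `c` at `T`, if the next prediction is at `τ`,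
      -- whose timing is fixed, or depends on public signals and on what is known at `T`
      (∀ (π : Policy N K) (T : ℕ) (hT : T ∈ K) (τ : World → ℕ),
        (∀ ω, 1 ≤ τ ω ∧ τ ω < T) →
        (∀ ω, (π.act (τ ω) ω).isSome) →
        (∀ ω i, τ ω < i → i < T → π.act i ω = none) →
        (∀ t, MeasurableSet[expertInfo N T ⊔
          ⨆ i ∈ Finset.Icc t N, MeasurableSpace.comap (marketSignal i) inferInstance]
            {ω | τ ω = t}) →
        ∀ (c : World → ℝ) (hc : Measurable[expertInfo N T] c),
        MemLp c 2 (worldLaw q N x) →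
        let ΔW : World → ℝ := fun ω =>
          totalReward (faceValue q N) (π.misreport hK T hT c hc) ω -
          totalReward (faceValue q N)
            (π.misreport hK T hT (fun _ => 0) (@measurable_const _ _ _ (expertInfo N T) 0)) ω
        let cτ : World → ℝ := fun ω => marketVar q T (τ ω) / expertVar q T * c ω
        Integrable ΔW (worldLaw q N x) ∧
        Integrable (fun ω => cτ ω ^ 2 / (2 * marketVar q T (τ ω))) (worldLaw q N x) ∧
        (worldLaw q N x)[ΔW | expertInfo N T] =ᵐ[worldLaw q N x]
          (fun ω => ((worldLaw q N x)[fun ω => cτ ω ^ 2 / (2 * marketVar q T (τ ω)) |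
            expertInfo N T]) ω - c ω ^ 2 / (2 * expertVar q T)) ∧
        (worldLaw q N x)[ΔW | expertInfo N T] ≤ᵐ[worldLaw q N x] 0) := by
  refine ⟨fun f hf => lintegral_flatLaw q N f hf, fun x => ⟨fun t ht => ?_,
    isEquilibrium_truthful hq0 hq1 N hK x, ?_, ?_⟩⟩
  · obtain ⟨ht1, htN⟩ := Finset.mem_Icc.1 ht
    exact outcomeGiven_expertInfo hq0 hq1 x ht1 htN
  · intro t T _ htT hTN xs r z _ hr
    -- The witness is the unperturbed market mean; it depends on the signals, but the slope in `c`
    -- does not.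
    refine ⟨marketMean q T t z (xs T) (xs t), fun c => ?_⟩
    rw [← marketMean_add]
    exact faceValueBefore_update q htT hTN xs r (z + c) hr
  · intro π T hT τ hτT hτ hn hτm c hc hc2
    exact misreport_gain hq0 hq1 hK x π hT hτT hτ hn hτm hc _ hc2
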